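/- **Framed knotted graphs.** A *diagram* is a plane diagram of a 4-regular graph in $\mathbb R^3$ (multiple edges and self-loops allowed, every edge ending at vertices). At each vertex two opposite edge ends lie above the projection plane ("over") and the other two below it ("under"); edges cross each other transversally, with over/under information. Every edge carries a twist $n\in\mathbb Z$, meaning a rotation of its triangular cross-section by $n\pi/3$, relative to the plane, positive if right-handed. Only diagrams whose twists *match* the vertices are considered: the twist of an edge is even if its ends are both over or both under, and odd otherwise. A *framed graph* is a class of diagrams under plane isotopy and the generalized Reidemeister moves: a curl in an edge may be exchanged for a twist of $\pm6$, the sign being that of the crossing (so two opposite curls cancel); the usual RII and RIII; RIV, moving a strand over or under a vertex; and RV, replacing a vertex by the vertex with over and under pairs exchanged, followed by a crossing between two neighbouring edge ends and by twists $\pm2$ on these two and $\mp1$ on the other two edge ends. The sign $\pm$ is that of this crossing, with both strands directed away from the vertex, and the crossing is such that the strand that passes over it belongs to the edge end that is over at the original vertex. **Dual triangulation.** A diagram has a dual generalized triangulation: one tetrahedron for each vertex, its faces corresponding to the four edge ends, the two faces at the ends of each edge being glued to each other as its twist prescribes. (In the cross-section of an edge that is over, resp. under, at a vertex, one side is parallel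 to the plane and lies in front of, resp. behind, the opposite corner.) A framed graph is dual to a triangulation of a 3-manifold $M$ if the tetrahedra, so glued, form a space homeomorphic to $M$. **Pachner graph.** $\mathscr P_G(M)$ is the graph whose nodes are the framed graphs dual to a triangulation of $M$, two nodes being adjacent if a graph Pachner move leads from one to the other. The graph Pachner moves are the following replacements in a disc and their inverses. *1-4 move.* A vertex with edge ends $A,B,C,D$ in clockwise order, $B,D$ over and $A,C$ under, is replaced by four vertices $v_A,v_B,v_C,v_D$ keeping these ends. In the projection they are the corners of a square with sides $v_Av_B,v_Bv_C,v_Cv_D,v_Dv_A$, of twists $+1,-1,+1,-1$, and with untwisted diagonals $v_Bv_D$ over $v_Av_C$. The ends $B,D$ and the diagonal $v_Bv_D$ are over at $v_B,v_D$, the ends $A,C$ and the diagonal $v_Av_C$ are under at $v_A,v_C$. *2-3 move.* Two vertices, one above the other in the plane, are joined by an untwisted vertical edge that is under at both; the upper one has ends $A,B,C$ to the left, top and right, and the lower one has ends $A',B',C'$ to the left, bottom and right. They are replaced by a vertex $u$ with ends $B$ (top) and $B'$ (bottom), a vertex $v$ to the left of $u$ with ends $A$ (top) and $A'$ (bottom),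 and a vertex $w$ to the right of $u$ with ends $C$ (top) and $C'$ (bottom). These ends are over at $v,w$ and under at $u$. The right end at $v$ is joined to the left end at $w$ by an untwisted edge passing over $B'$. The left end at $u$ passes under $A$ and is joined to the left end at $v$ with twist $-3$; the right end at $u$ passes under $C$ and is joined to the right end at $w$ with twist $+3$. The twists of $A,A',C,C'$ change by $-2,+2,+2,-2$. The mirror images of both moves in the projection plane (over and under exchanged, signs of twists reversed) are also included. **The link $L(G)$.** The *3-line graph* of a diagram $G$ is the link diagram in which every edge is replaced by three parallel lines (one for each side of its cross-section, so of each edge of a dual triangle), braided according to the twist, one crossing for each rotation by $\pi/3$. At a vertex the middle lines of opposite ends are joined and cross each other, the lines of the over pair passing over, and the outer lines are joined to those of the neighbouring ends. $L(G)$ is this link with all unlinked unknotted components removed. **Proposition.** Let $G_\pm$ be the diagram ($3^\ell5^\ell1^\pm$) with two vertices $v$ (below) and $w$ (above) and four edges joining them: two edges of twist $+2$, leaving $v$ at the upper left (over) and upper right (under), crossing each other once, and reaching $w$ at the lower right (over) and lower left (under), respectively; and two outer edges of twist $-1$, one leading around on the left from the lower left end at $v$ (under) to the upper left end at $w$ (over),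 one leading around on the right from the lower right end at $v$ (over) to the upper right end at $w$ (under). At the crossing, the edge that is over at $v$ and $w$ is the over-strand for $G_+$ and the under-strand for $G_-$. Then: 1. $G_+$ and $G_-$ are both dual to the same triangulation with two tetrahedra, in which the faces $(012),(013),(023),(123)$ of tetrahedron $0$ are glued to the faces $(320),(321),(301),(201)$ of tetrahedron $1$; and this is a triangulation of $S^3$. 2. $L(G_+)=\varnothing$, whereas $L(G_-)\ne\varnothing$; the 3-line graph of $G_-$ has two different components with nonzero linking number. 3. $G_+$ and $G_-$ lie in different connected components of $\mathscr P_G(S^3)$. In particular, the graph $\mathscr P_G(S^3)$ is not connected. -/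

import Mathlib

namespace PachnerGraphs

/-! ## Sliced plane diagrams

A plane diagram in general position with respect to the height function is recorded as a word of
elementary pieces, read from bottom to top.  The letter `(i, g)` means: the elementary piece `g`,
with `i` vertical strands to its left and any number of vertical strands to its right.  Strands may
carry colours, which the pieces have to match. -/

/-- Elementary pieces `G` with the colours of their bottom ends (`source`) and top ends (`target`),
both listed from left to right. -/
class Pieces (G : Type) (C : outParam Type) where
  source : G → List C
  target : G → List C

open Pieces

abbrev Word (G : Type) := List (ℕ × G)

/-- Put `k` further strands to the left. -/
def shift {G : Type} (k : ℕ) (w : Word G) : Word G := w.map fun x => (k + x.1, x.2)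

/-- The colours above a layer, from the colours below it; `none` if the layer does not fit. -/
def applyLayer {G C : Type} [Pieces G C] [DecidableEq C] (s : List C) (x : ℕ × G) :
    Option (List C) :=
  if x.1 ≤ s.length ∧ source x.2 <+: s.drop x.1 then
    some (s.take x.1 ++ target x.2 ++ (s.drop x.1).drop (source x.2).length)
  else none

/-- The colours of the strands above the whole word, from those below it. -/
def run {G C : Type} [Pieces G C] [DecidableEq C] : List C → Word G → Option (List C)
  | s, [] => some s
  | s, x :: w => (applyLayer s x).bind fun t => run t w

/-- `w'` is obtained from `w` by one local replacement `a ↦ b` with `R a b`. -/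
def LocalStep {G : Type} (R : Word G → Word G → Prop) (w w' : Word G) : Prop :=
  ∃ (pre post a b : Word G) (k : ℕ), R a b ∧
    w = pre ++ shift k a ++ post ∧ w' = pre ++ shift k b ++ post

/-- The arc `(l, p)` of a word is the strand in position `p` just below layer `l`. -/
abbrev Arc := ℕ × ℕ

/-- `(l, p)` really is one of the strands of the diagram. -/
def IsArc {G C : Type} [Pieces G C] [DecidableEq C] (w : Word G) (x : Arc) : Prop :=
  ∃ s : List C, run [] (w.take x.1) = some s ∧ x.2 < s.length

/-- The strands that run vertically beside the elementary piece of a layer. -/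
inductive Passes {G C : Type} [Pieces G C] (w : Word G) : Arc → Arc → Prop
  | left {l i p : ℕ} {g : G} : w[l]? = some (i, g) → p < i → Passes w (l, p) (l + 1, p)
  | right {l i : ℕ} {g : G} (q : ℕ) : w[l]? = some (i, g) →
      Passes w (l, i + (source g).length + q) (l + 1, i + (target g).length + q)

/-! ## Links -/

/-- `cross true`: the strand from bottom left to top right is the over-strand.
`cross false`: the strand from bottom right to top left is the over-strand. -/
inductive LinkPiece
  | cup
  | cap
  | cross (s : Bool)

instance : Pieces LinkPiece Unit where
  source
    | .cup => []
    | .cap => [(), ()]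
    | .cross _ => [(), ()]
  target
    | .cup => [(), ()]
    | .cap => []
    | .cross _ => [(), ()]

/-- Diagrams of (unframed, unoriented) links. -/
def LinkDiagram := {w : Word LinkPiece // run [] w = some []}

open LinkPiece in
/-- Plane isotopies (up to `cupSwing`) and the three Reidemeister moves for link diagrams. -/
inductive LinkMove : Word LinkPiece → Word LinkPiece → Prop
  | far (x y : LinkPiece) (k : ℕ) :
      LinkMove [(0, x), ((target x).length + k, y)] [((source x).length + k, y), (0, x)]
  | zigzag₁ : LinkMove [(0, cup), (1, cap)] []
  | zigzag₂ : LinkMove [(1, cup), (0, cap)] []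
  | capSwing (s : Bool) : LinkMove [(0, cross s), (1, cap)] [(1, cross !s), (0, cap)]
  | cupSwing (s : Bool) : LinkMove [(1, cup), (0, cross s)] [(0, cup), (1, cross !s)]
  | RI₁ (s : Bool) : LinkMove [(1, cup), (0, cross s), (1, cap)] []
  | RI₂ (s : Bool) : LinkMove [(0, cup), (1, cross s), (0, cap)] []
  | RII (s : Bool) : LinkMove [(0, cross s), (0, cross !s)] []
  | RIII (s s' s'' : Bool) (h : s = s'' → s' = s) :
      LinkMove [(0, cross s), (1, cross s'), (0, cross s'')]
        [(1, cross s''), (0, cross s'), (1, cross s)]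

/-- Deletion of a circle that bounds an empty disc of the plane. -/
inductive CircleDeletion : Word LinkPiece → Word LinkPiece → Prop
  | circle : CircleDeletion [(0, .cup), (0, .cap)] []

/-- Links up to isotopy and up to insertion and deletion of unlinked unknotted components, that is,
links with all unlinked unknotted components removed. -/
def ReducedLink :=
  Quot fun K K' : LinkDiagram =>
    LocalStep (fun a b => LinkMove a b ∨ CircleDeletion a b) K.1 K'.1

/-- What remains of the link `K` when all unlinked unknotted components are removed. -/
def LinkDiagram.reduce (K : LinkDiagram) : ReducedLink := Quot.mk _ K

/-- The empty link. -/
def ReducedLink.empty : ReducedLink := LinkDiagram.reduce ⟨[], rfl⟩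

/-- An arc with a direction: `true` is upwards. -/
abbrev DirArc := Arc × Bool

/-- Following a link from an arc, in a given direction, across one layer. -/
inductive Follows (w : Word LinkPiece) : DirArc → DirArc → Prop
  | pass {x y : Arc} (d : Bool) : Passes w x y → Follows w (x, d) (y, d)
  | cup {l i : ℕ} (d : Bool) : w[l]? = some (i, .cup) →
      Follows w ((l + 1, i), d) ((l + 1, i + 1), !d)
  | cap {l i : ℕ} (d : Bool) : w[l]? = some (i, .cap) →
      Follows w ((l, i), d) ((l, i + 1), !d)
  | cross₁ {l i : ℕ} {s : Bool} (d : Bool) : w[l]? = some (i, .cross s) →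
      Follows w ((l, i), d) ((l + 1, i + 1), d)
  | cross₂ {l i : ℕ} {s : Bool} (d : Bool) : w[l]? = some (i, .cross s) →
      Follows w ((l, i + 1), d) ((l + 1, i), d)

/-- The directed arcs `x` and `y` lie on the same component, with the same orientation of it. -/
def SameOriented (w : Word LinkPiece) : DirArc → DirArc → Prop := Relation.EqvGen (Follows w)

/-- The arcs `x` and `y` lie on the same component. -/
def SameComponent (w : Word LinkPiece) (x y : Arc) : Prop :=
  ∃ d d' : Bool, SameOriented w (x, d) (y, d')

open Classical in
/-- The linking number of the oriented components through `x` and `y` (assumed to be different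
components): half the sum of the signs of the crossings between them. -/
noncomputable def linkingNumber (w : Word LinkPiece) (x y : DirArc) : ℚ :=
  (∑ l ∈ Finset.range w.length,
    match w[l]? with
    | some (i, .cross s) =>
        ∑ d : Bool, ∑ d' : Bool,
          if (SameOriented w x ((l, i), d) ∧ SameOriented w y ((l, i + 1), d')) ∨
              (SameOriented w y ((l, i), d) ∧ SameOriented w x ((l, i + 1), d')) then
            (if s = (d == d') then 1 else -1)
          else 0
    | _ => 0) / 2

/-! ## Framed knotted 4-regular graphs

At a vertex two opposite edges lie above the projection plane and the other two below it.  A framed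
edge has a triangular cross-section.  At every point of an edge away from its twists, one side of the
triangle is parallel to the projection plane; it is either in front of the opposite corner (colour
`true`, "over", as at the end of an edge that leaves its vertex above the plane) or behind it (colour
`false`, "under").  A twist by `± π / 3` exchanges the two colours.  So an edge carries a colouring,
which is then unique, exactly if its total twist is even in case its two ends are both over or both
under, and odd otherwise, i.e. exactly if the twist matches the states of the vertices. -/

/-- `vertex s`: the edges at bottom left and top right are opposite to each other, as are those at
bottom right and top left; the former pair is above the plane if `s = true`, the latter if
`s = false`.
`cross t u s`: strands of colour `t` (from bottom left to top right) and `u`, the former being the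
over-strand if `s = true`, and the under-strand if `s = false`.
`twist t b`: a twist by `π / 3` (right-handed if `b = true`, left-handed if `b = false`) in a strand
of colour `t` below the twist. -/
inductive GraphPiece
  | cup (t : Bool)
  | cap (t : Bool)
  | cross (t u : Bool) (s : Bool)
  | vertex (s : Bool)
  | twist (t : Bool) (b : Bool)

instance : Pieces GraphPiece Bool where
  source
    | .cup _ => []
    | .cap t => [t, t]
    | .cross t u _ => [t, u]
    | .vertex s => [s, !s]
    | .twist t _ => [t]
  target
    | .cup t => [t, t]
    | .cap _ => []
    | .cross t u _ => [u, t]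
    | .vertex s => [!s, s]
    | .twist t _ => [!t]

/-- The four edge ends at a vertex: bottom left, bottom right, top left, top right. -/
inductive Leg
  | BL | BR | TL | TR
  deriving DecidableEq

/-- The vertices of a diagram, each given by its layer and its position. -/
def Vertex (w : Word GraphPiece) := {x : ℕ × ℕ // ∃ s, w[x.1]? = some (x.2, .vertex s)}

/-- The arc at an edge end. -/
def Vertex.arc {w : Word GraphPiece} (v : Vertex w) : Leg → Arc
  | .BL => (v.1.1, v.1.2)
  | .BR => (v.1.1, v.1.2 + 1)
  | .TL => (v.1.1 + 1, v.1.2)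
  | .TR => (v.1.1 + 1, v.1.2 + 1)

/-- A twist exchanges two of the three lines (sides of the cross-section, numbered `0, 1, 2` from left
to right in the projection), which cross there, namely those in positions `k` and `k + 1`, where `k`
is the following number. -/
def twistPosition (t b : Bool) : ℕ := if t = b then 1 else 0

/-- The resulting permutation of the three lines. -/
def twistPerm (t b : Bool) : Equiv.Perm (Fin 3) :=
  if t = b then Equiv.swap 1 2 else Equiv.swap 0 1

/-- Following one of the three lines of a framed edge (not through a vertex) across one layer. -/
inductive LineStep (w : Word GraphPiece) : Arc × Fin 3 → Arc × Fin 3 → Prop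
  | pass {x y : Arc} (j : Fin 3) : Passes w x y → LineStep w (x, j) (y, j)
  | cup {l i : ℕ} {t : Bool} (j : Fin 3) : w[l]? = some (i, .cup t) →
      LineStep w ((l + 1, i), j) ((l + 1, i + 1), j.rev)
  | cap {l i : ℕ} {t : Bool} (j : Fin 3) : w[l]? = some (i, .cap t) →
      LineStep w ((l, i), j) ((l, i + 1), j.rev)
  | cross₁ {l i : ℕ} {t u s : Bool} (j : Fin 3) : w[l]? = some (i, .cross t u s) →
      LineStep w ((l, i), j) ((l + 1, i + 1), j)
  | cross₂ {l i : ℕ} {t u s : Bool} (j : Fin 3) : w[l]? = some (i, .cross t u s) →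
      LineStep w ((l, i + 1), j) ((l + 1, i), j)
  | twist {l i : ℕ} {t b : Bool} (j : Fin 3) : w[l]? = some (i, .twist t b) →
      LineStep w ((l, i), j) ((l + 1, i), twistPerm t b j)

/-- Two line points on the same line of the same edge. -/
def SameLine (w : Word GraphPiece) : Arc × Fin 3 → Arc × Fin 3 → Prop :=
  Relation.EqvGen (LineStep w)

/-- Two arcs on the same edge. -/
def SameEdge (w : Word GraphPiece) (x y : Arc) : Prop := ∃ j j' : Fin 3, SameLine w (x, j) (y, j')

/-- Diagrams of framed knotted 4-regular graphs (multiple edges and self-loops are allowed) whose edge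
twists match the vertex states.  Closed curves without vertices do not occur in a graph. -/
structure GraphDiagram where
  word : Word GraphPiece
  closed : run [] word = some []
  noCircles : ∀ x : Arc, IsArc word x → ∃ (v : Vertex word) (a : Leg), SameEdge word x (v.arc a)

/-- `n` successive twists by `π / 3` in the strand at position `p`, which has colour `t` below
them. -/
def twists (p : ℕ) (t b : Bool) : ℕ → Word GraphPiece
  | 0 => []
  | n + 1 => (p, .twist t b) :: twists p (!t) b n

open GraphPiece in
/-- The generalized Reidemeister moves on diagrams of framed graphs, together with plane isotopies
(up to `vertexCup`) and the sliding and cancelling of twists along an edge (up to `twistCross₂`).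
A single curl amounts to a full turn of the framing (`RI₁`, `RI₂`); so two opposite curls cancel. -/
inductive IsotopyMove : Word GraphPiece → Word GraphPiece → Prop
  | far (x y : GraphPiece) (k : ℕ) :
      IsotopyMove [(0, x), ((target x).length + k, y)] [((source x).length + k, y), (0, x)]
  | zigzag₁ (t : Bool) : IsotopyMove [(0, cup t), (1, cap t)] []
  | zigzag₂ (t : Bool) : IsotopyMove [(1, cup t), (0, cap t)] []
  | crossCap (t u s : Bool) :
      IsotopyMove [(0, cross t u s), (1, cap t)] [(1, cross u t !s), (0, cap t)]
  | crossCup (t u s : Bool) :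
      IsotopyMove [(1, cup t), (0, cross u t s)] [(0, cup t), (1, cross t u !s)]
  | vertexCap (s : Bool) :
      IsotopyMove [(0, vertex s), (1, cap s)] [(1, vertex !s), (0, cap s)]
  | vertexCup (s : Bool) :
      IsotopyMove [(1, cup !s), (0, vertex s)] [(0, cup !s), (1, vertex !s)]
  | twistCancel (t b : Bool) : IsotopyMove [(0, twist t b), (0, twist (!t) (!b))] []
  | twistCap (t b : Bool) :
      IsotopyMove [(0, twist t b), (0, cap !t)] [(1, twist (!t) b), (0, cap t)]
  | twistCup (t b : Bool) :
      IsotopyMove [(0, cup t), (0, twist t b)] [(0, cup !t), (1, twist (!t) b)]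
  | twistCross₁ (t u s b : Bool) :
      IsotopyMove [(0, twist t b), (0, cross (!t) u s)] [(0, cross t u s), (1, twist t b)]
  | twistCross₂ (t u s b : Bool) :
      IsotopyMove [(1, twist u b), (0, cross t (!u) s)] [(0, cross t u s), (0, twist u b)]
  | RI₁ (t s : Bool) :
      IsotopyMove [(1, cup t), (0, cross t t s), (1, cap t)] (twists 0 t s 6)
  | RI₂ (t s : Bool) :
      IsotopyMove [(0, cup t), (1, cross t t s), (0, cap t)] (twists 0 t s 6)
  | RII (t u s : Bool) : IsotopyMove [(0, cross t u s), (0, cross u t !s)] []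
  | RIII (t u v s s' s'' : Bool) (h : s = s'' → s' = s) :
      IsotopyMove [(0, cross t u s), (1, cross t v s'), (0, cross u v s'')]
        [(1, cross u v s''), (0, cross t v s'), (1, cross t u s)]
  | RIV₁ (s t c : Bool) :
      IsotopyMove [(0, vertex s), (1, cross s t c), (0, cross (!s) t c)]
        [(1, cross (!s) t c), (0, cross s t c), (1, vertex s)]
  | RIV₂ (s t c : Bool) :
      IsotopyMove [(1, vertex s), (0, cross t (!s) c), (1, cross t s c)]
        [(0, cross t s c), (1, cross t (!s) c), (0, vertex s)]
  | RV (s : Bool) :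
      IsotopyMove [(0, vertex s)]
        (twists 0 s (!s) 1 ++ twists 1 (!s) (!s) 1 ++ [(0, vertex !s), (0, cross s (!s) s)] ++
          twists 0 (!s) s 2 ++ twists 1 s s 2)

/-- Framed knotted 4-regular graphs: diagrams up to generalized Reidemeister moves. -/
def FramedGraph :=
  Quot fun D D' : GraphDiagram => LocalStep IsotopyMove D.word D'.word

/-- The framed graph of a diagram. -/
def GraphDiagram.graph (D : GraphDiagram) : FramedGraph := Quot.mk _ D

open GraphPiece in
/-- The graph Pachner moves, read from left to right; read from right to left they are the 4-1 move and
the 3-2 move.  In the 1-4 move a vertex is replaced by four vertices that are pairwise joined, each of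
them keeping one of the old edge ends.  The 2-3 move acts on two vertices that are both over or both
under at a common edge without twist; they are replaced by three vertices that are pairwise joined, each of
them keeping one old edge end of either vertex. -/
inductive PachnerMove : Word GraphPiece → Word GraphPiece → Prop
  | move14 (s : Bool) :
      PachnerMove [(0, vertex s)]
        ([(1, cup s)] ++ twists 1 s s 1 ++
          [(0, vertex s), (2, vertex s), (1, cross s (!s) s)] ++
          twists 0 (!s) (!s) 1 ++ twists 3 s (!s) 1 ++
          [(0, vertex s), (2, vertex s)] ++ twists 1 s s 1 ++ [(1, cap !s)])
  | move23 (s : Bool) :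
      PachnerMove [(0, vertex s), (1, cap s), (1, cup s), (0, vertex !s)]
        (twists 0 s s 2 ++ twists 2 s (!s) 2 ++
          [(0, cup !s), (1, vertex !s), (2, cross (!s) (!s) s), (3, vertex !s)] ++
          twists 0 (!s) (!s) 3 ++ twists 4 (!s) s 3 ++
          [(0, cross s s !s), (3, cross s s s), (1, vertex s), (2, cap s)] ++
          twists 0 s (!s) 2 ++ twists 2 s s 2)

/-! ## The dual triangulation -/

/-- A (closed) generalized triangulation: tetrahedra with vertices `0, 1, 2, 3`, all of whose faces are
glued in pairs.  Face `f` of a tetrahedron is the one opposite to its vertex `f`.  If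
`glue t f = (t', σ)`, then face `f` of `t` is glued to face `σ f` of `t'`, each vertex `i ≠ f` of the
former to the vertex `σ i` of the latter. -/
structure Triangulation where
  size : ℕ
  glue : Fin size → Fin 4 → Fin size × Equiv.Perm (Fin 4)
  glue_symm : ∀ t f, glue (glue t f).1 ((glue t f).2 f) = (t, (glue t f).2.symm)
  glue_ne : ∀ t f, ((glue t f).1, (glue t f).2 f) ≠ (t, f)

/-- The topological space obtained by gluing the tetrahedra. -/
def Triangulation.Realization (T : Triangulation) : Type :=
  Quot fun x y : Fin T.size × stdSimplex ℝ (Fin 4) =>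
    ∃ f : Fin 4, x.2.1 f = 0 ∧ y.1 = (T.glue x.1 f).1 ∧
      ∀ i, y.2.1 ((T.glue x.1 f).2 i) = x.2.1 i

instance (T : Triangulation) : TopologicalSpace T.Realization :=
  inferInstanceAs (TopologicalSpace (Quot _))

/-- `T` triangulates the space `M`. -/
def Triangulation.Triangulates (T : Triangulation) (M : Type) [TopologicalSpace M] : Prop :=
  Nonempty (T.Realization ≃ₜ M)

/-- Line `j` of the edge end `a` continues, at the vertex, to the edge end `lineLeg a j`.  The vertices
of the dual tetrahedron correspond to the edge ends, and the face dual to `a` is opposite to the vertex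
`a`; its side dual to line `j` is shared with the face dual to `lineLeg a j`, and therefore opposite,
in the face of `a`, to the corner `lineLeg a j`. -/
def lineLeg : Leg → Fin 3 → Leg
  | .BL => ![.TL, .TR, .BR]
  | .BR => ![.BL, .TL, .TR]
  | .TL => ![.BL, .BR, .TR]
  | .TR => ![.TL, .BL, .BR]

/-- `T` is, up to labelling, the triangulation dual to the diagram: its tetrahedra correspond to the
vertices of the graph, their faces to the edge ends, and the faces at the two ends of an edge are glued
such that sides are identified if they belong to the same line of the edge. -/
def GraphDiagram.IsDual (D : GraphDiagram) (T : Triangulation) : Prop :=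
  ∃ (e : Vertex D.word ≃ Fin T.size) (lab : Vertex D.word → (Leg ≃ Fin 4)),
    ∀ (v v' : Vertex D.word) (a a' : Leg), (v, a) ≠ (v', a') →
      SameEdge D.word (v.arc a) (v'.arc a') →
        ∃ σ : Equiv.Perm (Fin 4), T.glue (e v) (lab v a) = (e v', σ) ∧
          σ (lab v a) = lab v' a' ∧
          ∀ j j' : Fin 3, SameLine D.word (v.arc a, j) (v'.arc a', j') →
            σ (lab v (lineLeg a j)) = lab v' (lineLeg a' j')

/-! ## The Pachner graph -/

/-- The framed graph is dual to a triangulation of `M`. -/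
def FramedGraph.IsDualTo (g : FramedGraph) (M : Type) [TopologicalSpace M] : Prop :=
  ∃ D : GraphDiagram, D.graph = g ∧ ∃ T : Triangulation, D.IsDual T ∧ T.Triangulates M

/-- The Pachner graph of `M`: its nodes are the framed knotted 4-regular graphs dual to a triangulation
of `M`, two of which are adjacent if some graph Pachner move leads from one to the other. -/
def pachnerGraph (M : Type) [TopologicalSpace M] :
    SimpleGraph {g : FramedGraph // g.IsDualTo M} :=
  SimpleGraph.fromRel fun g h =>
    ∃ D D' : GraphDiagram, D.graph = g.1 ∧ D'.graph = h.1 ∧ LocalStep PachnerMove D.word D'.word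

/-- The 3-sphere. -/
abbrev Sphere3 : Type := Metric.sphere (0 : EuclideanSpace ℝ (Fin 4)) 1

/-! ## The 3-line graph and the link `L` -/

/-- The 3-line graph of an elementary piece: each framed edge becomes three parallel lines.  At a vertex,
the middle lines go straight through and cross each other, while the outer lines turn to the
neighbouring edges. -/
def threeLinePiece : GraphPiece → Word LinkPiece
  | .cup _ => [(0, .cup), (1, .cup), (2, .cup)]
  | .cap _ => [(2, .cap), (1, .cap), (0, .cap)]
  | .cross _ _ s =>
      [(2, .cross s), (3, .cross s), (4, .cross s), (1, .cross s), (2, .cross s), (3, .cross s),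
        (0, .cross s), (1, .cross s), (2, .cross s)]
  | .vertex s => [(2, .cap), (1, .cross s), (2, .cup)]
  | .twist t b => [(twistPosition t b, .cross b)]

/-- The 3-line graph of a diagram. -/
def threeLineWord (w : Word GraphPiece) : Word LinkPiece :=
  w.flatMap fun x => shift (3 * x.1) (threeLinePiece x.2)

theorem applyLayer_context {G C : Type} [Pieces G C] [DecidableEq C] {s t : List C} {x : ℕ × G}
    (h : applyLayer s x = some t) (p q : List C) :
    applyLayer (p ++ s ++ q) (p.length + x.1, x.2) = some (p ++ t ++ q) := by
  unfold applyLayer at h ⊢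
  split_ifs at h with hc
  obtain ⟨h1, r, hr⟩ := hc
  have e1 : (p ++ s ++ q).drop (p.length + x.1) = source x.2 ++ (r ++ q) := by
    rw [List.append_assoc, List.drop_append, ← List.append_assoc, hr]
    simp [List.drop_append, Nat.sub_eq_zero_of_le h1]
  have e2 : (p ++ s ++ q).take (p.length + x.1) = p ++ s.take x.1 := by
    rw [List.append_assoc, List.take_append]
    simp [List.take_append, Nat.sub_eq_zero_of_le h1]
  rw [if_pos]
  · simp only [Option.some.injEq] at h ⊢
    rw [← h, e2]
    simp only [e1, ← hr]
    simp
  · refine ⟨by simp; omega, ?_⟩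
    rw [show ((p.length + x.1, x.2) : ℕ × G).1 = p.length + x.1 from rfl, e1]
    exact ⟨_, rfl⟩

theorem run_context {G C : Type} [Pieces G C] [DecidableEq C] (w : Word G) {s t : List C}
    (h : run s w = some t) (p q : List C) :
    run (p ++ s ++ q) (shift p.length w) = some (p ++ t ++ q) := by
  induction w generalizing s with
  | nil => simp_all [run, shift]
  | cons x w ih =>
    simp only [run, Option.bind_eq_some_iff] at h
    obtain ⟨u, hu, hw⟩ := h
    simp only [shift, List.map_cons, run]
    rw [applyLayer_context hu]
    exact ih hw

theorem run_append {G C : Type} [Pieces G C] [DecidableEq C] (w w' : Word G) (s : List C) :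
    run s (w ++ w') = (run s w).bind fun t => run t w' := by
  induction w generalizing s with
  | nil => rfl
  | cons x w ih => simp [run, ih, Option.bind_assoc]

theorem run_threeLinePiece (g : GraphPiece) :
    run (List.replicate (3 * (source g).length) ()) (threeLinePiece g) =
      some (List.replicate (3 * (target g).length) ()) := by
  cases g with
  | cup t => rfl
  | cap t => rfl
  | cross t u s => rfl
  | vertex s => rfl
  | twist t b => cases t <;> cases b <;> rfl

theorem run_threeLineWord (w : Word GraphPiece) {s t : List Bool} (h : run s w = some t) :
    run (List.replicate (3 * s.length) ()) (threeLineWord w) =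
      some (List.replicate (3 * t.length) ()) := by
  induction w generalizing s with
  | nil => simp_all [run, threeLineWord]
  | cons x w ih =>
    simp only [run, Option.bind_eq_some_iff] at h
    obtain ⟨u, hu, hw⟩ := h
    have := ih hw
    simp only [threeLineWord, List.flatMap_cons] at this ⊢
    rw [run_append]
    unfold applyLayer at hu
    split_ifs at hu with hc
    obtain ⟨h1, r, hr⟩ := hc
    simp only [Option.some.injEq] at hu
    have hs : s = s.take x.1 ++ source x.2 ++ r := by
      rw [List.append_assoc, hr, List.take_append_drop]
    have hl : (s.take x.1).length = x.1 := by simp [h1]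
    have hu' : u = s.take x.1 ++ target x.2 ++ r := by
      rw [← hu, ← hr]; simp
    have key := run_context _ (run_threeLinePiece x.2) (List.replicate (3 * x.1) ())
      (List.replicate (3 * r.length) ())
    simp only [List.length_replicate, List.replicate_append_replicate] at key
    have n1 : 3 * s.length = 3 * x.1 + 3 * (source x.2).length + 3 * r.length := by
      conv_lhs => rw [hs]
      simp [hl]; omega
    have n2 : 3 * u.length = 3 * x.1 + 3 * (target x.2).length + 3 * r.length := by
      rw [hu']; simp [hl]; omega
    rw [n1, key, ← n2]
    exact this

/-- The 3-line graph, regarded as a link diagram. -/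
def GraphDiagram.threeLine (D : GraphDiagram) : LinkDiagram :=
  ⟨threeLineWord D.word, run_threeLineWord D.word D.closed⟩

/-- The link `L(G)`: the 3-line graph, regarded as a link, with all unlinked unknotted components
removed. -/
def GraphDiagram.L (D : GraphDiagram) : ReducedLink := D.threeLine.reduce

/-! ## The two examples -/

open GraphPiece in
/-- Two vertices `v` (below) and `w` (above), joined by four edges.  Two of the edges have twist `+2` and
cross each other once: one is over at both `v` and `w`, the other is under at both.  The two remaining,
outer edges have twist `-1`: the left one leaves `v` under and reaches `w` over, the right one leaves `v`
over and reaches `w` under.  At the crossing, the edge that is over at both vertices is the over-strand if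
`s = true`, and the under-strand if `s = false`. -/
def exampleWord (s : Bool) : Word GraphPiece :=
  [(0, cup false), (2, cup true), (1, vertex false)] ++
    twists 1 true true 2 ++ twists 2 false true 2 ++
    [(1, cross true false s), (1, vertex false)] ++
    twists 0 false false 1 ++ twists 3 true false 1 ++ [(0, cap true), (0, cap false)]

/-- The arc belongs to an edge. -/
def OnEdge (w : Word GraphPiece) (x : Arc) : Prop :=
  ∃ (v : Vertex w) (a : Leg), ∀ j, ∃ j', SameLine w (x, j) (v.arc a, j')

theorem onEdge_iff {w : Word GraphPiece} {x y : Arc} (f : Equiv.Perm (Fin 3))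
    (h : ∀ j, LineStep w (x, j) (y, f j)) : OnEdge w x ↔ OnEdge w y := by
  constructor
  · rintro ⟨v, a, hv⟩
    refine ⟨v, a, fun j => ?_⟩
    obtain ⟨j', hj'⟩ := hv (f.symm j)
    refine ⟨j', .trans _ _ _ (.symm _ _ (.rel _ _ ?_)) hj'⟩
    simpa using h (f.symm j)
  · rintro ⟨v, a, hv⟩
    refine ⟨v, a, fun j => ?_⟩
    obtain ⟨j', hj'⟩ := hv (f j)
    exact ⟨j', .trans _ _ _ (.rel _ _ (h j)) hj'⟩

theorem onEdge_left {w : Word GraphPiece} {l i p : ℕ} {g : GraphPiece} (h : w[l]? = some (i, g))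
    (hp : p < i) : OnEdge w (l, p) ↔ OnEdge w (l + 1, p) :=
  onEdge_iff 1 fun j => .pass j (.left h hp)

theorem onEdge_right {w : Word GraphPiece} {l i p p' : ℕ} {g : GraphPiece}
    (h : w[l]? = some (i, g)) (h₁ : i + (source g).length ≤ p)
    (h₂ : p' + (source g).length = p + (target g).length) :
    OnEdge w (l, p) ↔ OnEdge w (l + 1, p') := by
  obtain ⟨q, rfl⟩ := Nat.exists_eq_add_of_le h₁
  obtain rfl : p' = i + (target g).length + q := by omega
  exact onEdge_iff 1 fun j => .pass j (.right q h)

theorem onEdge_twist {w : Word GraphPiece} {l i : ℕ} {t b : Bool}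
    (h : w[l]? = some (i, .twist t b)) : OnEdge w (l, i) ↔ OnEdge w (l + 1, i) :=
  onEdge_iff (twistPerm t b) fun j => .twist j h

theorem exampleWord_closed (s : Bool) : run [] (exampleWord s) = some [] := by
  cases s <;> rfl

theorem exampleWord_noCircles (s : Bool) (x : Arc) (hx : IsArc (exampleWord s) x) :
    ∃ (v : Vertex (exampleWord s)) (a : Leg), SameEdge (exampleWord s) x (v.arc a) := by
  suffices h : OnEdge (exampleWord s) x by
    obtain ⟨v, a, h⟩ := h
    obtain ⟨j', h⟩ := h 0
    exact ⟨v, a, 0, j', h⟩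
  have base : ∀ (v : Vertex (exampleWord s)) (a : Leg), OnEdge (exampleWord s) (v.arc a) :=
    fun v a => ⟨v, a, fun j => ⟨j, .refl _⟩⟩
  let v : Vertex (exampleWord s) := ⟨(2, 1), false, rfl⟩
  let w : Vertex (exampleWord s) := ⟨(8, 1), false, rfl⟩
  have a21 : OnEdge (exampleWord s) (2, 1) := base v .BL
  have a22 : OnEdge (exampleWord s) (2, 2) := base v .BR
  have a31 : OnEdge (exampleWord s) (3, 1) := base v .TL
  have a32 : OnEdge (exampleWord s) (3, 2) := base v .TR
  have a81 : OnEdge (exampleWord s) (8, 1) := base w .BL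
  have a82 : OnEdge (exampleWord s) (8, 2) := base w .BR
  have a91 : OnEdge (exampleWord s) (9, 1) := base w .TL
  have a92 : OnEdge (exampleWord s) (9, 2) := base w .TR
  have a41 := (onEdge_twist (l := 3) rfl).1 a31
  have a51 := (onEdge_twist (l := 4) rfl).1 a41
  have a61 := (onEdge_left (l := 5) rfl (by decide)).1 a51
  have a71 := (onEdge_left (l := 6) rfl (by decide)).1 a61
  have a42 := (onEdge_right (w := exampleWord s) (l := 3) (p := 2) (p' := 2) rfl
    (by decide) (by decide)).1 a32
  have a52 := (onEdge_right (w := exampleWord s) (l := 4) (p := 2) (p' := 2) rfl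
    (by decide) (by decide)).1 a42
  have a62 := (onEdge_twist (l := 5) rfl).1 a52
  have a72 := (onEdge_twist (l := 6) rfl).1 a62
  have a101 := (onEdge_right (w := exampleWord s) (l := 9) (p := 1) (p' := 1) rfl
    (by decide) (by decide)).1 a91
  have a111 := (onEdge_left (l := 10) rfl (by decide)).1 a101
  have a102 := (onEdge_right (w := exampleWord s) (l := 9) (p := 2) (p' := 2) rfl
    (by decide) (by decide)).1 a92
  have a112 := (onEdge_left (l := 10) rfl (by decide)).1 a102
  have a110 := (onEdge_iff (x := (11, 0)) (y := (11, 1)) Fin.revPerm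
    fun j => .cap j (rfl : (exampleWord s)[11]? = some (0, .cap true))).2 a111
  have a120 := (onEdge_right (w := exampleWord s) (l := 11) (p := 2) (p' := 0) rfl
    (by decide) (by decide)).1 a112
  have a121 := (onEdge_iff (x := (12, 0)) (y := (12, 1)) Fin.revPerm
    fun j => .cap j (rfl : (exampleWord s)[12]? = some (0, .cap false))).1 a120
  have a113 := (onEdge_right (w := exampleWord s) (l := 11) (p := 3) (p' := 1) rfl
    (by decide) (by decide)).2 a121
  have a11 := (onEdge_left (w := exampleWord s) (l := 1) rfl (by decide)).2 a21
  have a10 := (onEdge_iff (w := exampleWord s) (x := (1, 0)) (y := (1, 1)) Fin.revPerm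
    fun j => .cup j (rfl : (exampleWord s)[0]? = some (0, .cup false))).2 a11
  have a20 := (onEdge_left (l := 1) rfl (by decide)).1 a10
  have a23 := (onEdge_iff (w := exampleWord s) (x := (2, 2)) (y := (2, 3)) Fin.revPerm
    fun j => .cup j (rfl : (exampleWord s)[1]? = some (2, .cup true))).1 a22
  have a30 := (onEdge_left (l := 2) rfl (by decide)).1 a20
  have a40 := (onEdge_left (l := 3) rfl (by decide)).1 a30
  have a50 := (onEdge_left (l := 4) rfl (by decide)).1 a40
  have a60 := (onEdge_left (l := 5) rfl (by decide)).1 a50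
  have a70 := (onEdge_left (l := 6) rfl (by decide)).1 a60
  have a80 := (onEdge_left (l := 7) rfl (by decide)).1 a70
  have a90 := (onEdge_left (l := 8) rfl (by decide)).1 a80
  have a100 := (onEdge_twist (l := 9) rfl).1 a90
  have a33 := (onEdge_right (w := exampleWord s) (l := 2) (p := 3) (p' := 3) rfl
    (by decide) (by decide)).1 a23
  have a43 := (onEdge_right (w := exampleWord s) (l := 3) (p := 3) (p' := 3) rfl
    (by decide) (by decide)).1 a33
  have a53 := (onEdge_right (w := exampleWord s) (l := 4) (p := 3) (p' := 3) rfl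
    (by decide) (by decide)).1 a43
  have a63 := (onEdge_right (w := exampleWord s) (l := 5) (p := 3) (p' := 3) rfl
    (by decide) (by decide)).1 a53
  have a73 := (onEdge_right (w := exampleWord s) (l := 6) (p := 3) (p' := 3) rfl
    (by decide) (by decide)).1 a63
  have a83 := (onEdge_right (w := exampleWord s) (l := 7) (p := 3) (p' := 3) rfl
    (Nat.le_refl 3) rfl).1 a73
  have a93 := (onEdge_right (w := exampleWord s) (l := 8) (p := 3) (p' := 3) rfl
    (by decide) (by decide)).1 a83
  have a103 := (onEdge_right (w := exampleWord s) (l := 9) (p := 3) (p' := 3) rfl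
    (by decide) (by decide)).1 a93
  obtain ⟨l, p⟩ := x
  obtain ⟨c, hc, hp⟩ := hx
  simp only at hc hp
  have width : ∀ l < 14, ∀ c ∈ run [] ((exampleWord s).take l),
      c.length = ![0, 2, 4, 4, 4, 4, 4, 4, 4, 4, 4, 4, 2, 0] (Fin.ofNat 14 l) := by
    cases s <;> decide
  rcases lt_or_ge l 13 with hl | hl
  · have := width l (by omega) c hc
    rw [this] at hp
    clear this hc width
    interval_cases l <;> simp [Fin.ofNat] at hp <;> interval_cases p <;> assumption
  · rw [List.take_of_length_le (by exact hl), exampleWord_closed] at hc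
    cases hc
    simp at hp

/-- The graphs `3^ℓ 5^ℓ 1^+` (for `s = true`) and `3^ℓ 5^ℓ 1^-` (for `s = false`). -/
def exampleDiagram (s : Bool) : GraphDiagram :=
  ⟨exampleWord s, exampleWord_closed s, exampleWord_noCircles s⟩

/-- The permutation `0 ↦ 3, 1 ↦ 2, 2 ↦ 0, 3 ↦ 1`. -/
def examplePerm : Equiv.Perm (Fin 4) where
  toFun := ![3, 2, 0, 1]
  invFun := ![2, 3, 1, 0]
  left_inv := by decide
  right_inv := by decide

/-- Two tetrahedra, every face of the first being glued to a face of the second.  In the notation in which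
`t(abc)` is the face of tetrahedron `t` with vertices `a, b, c`, the faces `0(012), 0(013), 0(023),
0(123)` are glued to `1(320), 1(321), 1(301), 1(201)`. -/
def exampleTriangulation : Triangulation where
  size := 2
  glue t _ := if t = 0 then (1, examplePerm) else (0, examplePerm.symm)
  glue_symm := by decide
  glue_ne := by decide

end PachnerGraphs

open PachnerGraphs

/-!
The theorem rests on one invariant. Colour every component of a link diagram `true` or `false`, and
count modulo 2 the crossings at which a strand coloured `true` passes over a strand coloured
`false`. This parity is the linking number modulo 2 of the two parts of the link, so whether some
colouring gives an odd number (`OddColouring`) is a link invariant, and unlinked unknotted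
components do not affect it (`ReducedLink.Odd`). Moreover, all generalized Reidemeister moves and
all graph Pachner moves on framed graphs preserve it for the 3-line graph (`FramedGraph.Odd`,
`odd_iff_of_reachable`). Each 3-line graph of a move is a tangle, and the two tangles of a move
have the same colourings: colours at the ends and parity agree. As the colours of the components
are variables and the parity is a quadratic polynomial in them over the field with two elements,
this is a comparison of two polynomials, carried out by `equivCheck`; only far commutation, which
has an unbounded number of strands in between, needs a general argument (`colourEquiv_far`).

The first example has an empty reduced link by an explicit deformation (`L_exampleDiagram_true`),
hence no odd colouring, whereas the second example has one (`oddColouring_exampleWord_false`). So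
the two graphs lie in different components of the Pachner graph.

All four faces of the two tetrahedra are glued by one and the same permutation, hence the
triangulation is the double of a tetrahedron. It is mapped to the 3-sphere by bending the two
copies to either side of their common hyperplane and projecting centrally
(`exampleTriangulation_triangulates`). The linking number and the dual triangulation are read off
from labels that are constant along components (`exists_linkingNumber_ne_zero`) and along the lines
of edges (`exampleDiagram_isDual`).
-/

namespace PachnerGraphs
open Pieces

/-! ### Two-colourings of links -/

/-- The two-colourings of an elementary piece with given colours of the bottom ends: the colours of
the top ends, and whether a strand coloured `true` passes over a strand coloured `false`. -/
def pieceColourings : LinkPiece → List Bool → List (List Bool × Bool)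
  | .cup, [] => [([false, false], false), ([true, true], false)]
  | .cap, [x, y] => if x = y then [([], false)] else []
  | .cross s, [x, y] => [([y, x], bif s then x && !y else y && !x)]
  | _, _ => []

/-- `Colouring w s t b`: some two-colouring of the diagram `w` has the colours `s` at the bottom, the
colours `t` at the top, and the parity `b` of the number of crossings at which a strand coloured
`true` passes over a strand coloured `false`.  The strands of a component have the same colour.
Infinitely many strands to the right are taken into account, so that every word fits. -/
def Colouring : Word LinkPiece → Stream' Bool → Stream' Bool → Bool → Prop
  | [], s, t, b => s = t ∧ b = false
  | (i, g) :: w, s, t, b => ∃ (p u v : List Bool) (q : Stream' Bool) (c : Bool), p.length = i ∧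
      s = p ++ₛ (u ++ₛ q) ∧ (v, c) ∈ pieceColourings g u ∧ Colouring w (p ++ₛ (v ++ₛ q)) t (b ^^ c)

/-- All pairs of top colours and parity that the two-colourings of a word with given bottom colours
have. -/
def colourings : Word LinkPiece → List Bool → List (List Bool × Bool)
  | [], u => [(u, false)]
  | (i, g) :: w, u =>
      (pieceColourings g ((u.drop i).take (source g).length)).flatMap fun vc =>
        (colourings w (u.take i ++ vc.1 ++ u.drop (i + (source g).length))).map fun tb =>
          (tb.1, tb.2 ^^ vc.2)

/-- The number of strands above a word, from the number of strands below it; `none` if the word does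
not fit. -/
def width : Word LinkPiece → ℕ → Option ℕ
  | [], m => some m
  | (i, g) :: w, m =>
      if i + (source g).length ≤ m then width w (m - (source g).length + (target g).length)
      else none

theorem appendStream_inj {l l' : List Bool} {s s' : Stream' Bool} (hl : l.length = l'.length)
    (h : l ++ₛ s = l' ++ₛ s') : l = l' ∧ s = s' := by
  obtain rfl := Stream'.append_left_injective _ _ _ _ h hl
  exact ⟨rfl, Stream'.append_right_injective _ _ _ h⟩

theorem exists_appendStream (n : ℕ) (s : Stream' Bool) :
    ∃ (l : List Bool) (s' : Stream' Bool), l.length = n ∧ s = l ++ₛ s' :=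
  ⟨s.take n, s.drop n, Stream'.length_take _ _, (Stream'.append_take_drop n s).symm⟩

theorem length_of_mem_pieceColourings {g : LinkPiece} {u v : List Bool} {c : Bool}
    (h : (v, c) ∈ pieceColourings g u) :
    u.length = (source g).length ∧ v.length = (target g).length := by
  rcases g with _ | _ | s <;> rcases u with _ | ⟨x, _ | ⟨y, _ | ⟨z, u⟩⟩⟩ <;>
    simp [pieceColourings] at h <;> simp [source, target]
  · rcases h with h | h <;> simp [h]
  · simp [h]
  · simp [h]

/-- Only finitely many strands matter to the colourings of a word that fits. -/
theorem colouring_append_iff (w : Word LinkPiece) {u : List Bool} {n : ℕ}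
    (h : width w u.length = some n) (τ t : Stream' Bool) (b : Bool) :
    Colouring w (u ++ₛ τ) t b ↔
      ∃ v : List Bool, v.length = n ∧ (v, b) ∈ colourings w u ∧ t = v ++ₛ τ := by
  induction w generalizing u b with
  | nil =>
    simp only [width, Option.some.injEq] at h
    simp only [Colouring, colourings, List.mem_singleton, Prod.mk.injEq]
    constructor
    · rintro ⟨rfl, rfl⟩
      exact ⟨u, h, ⟨rfl, rfl⟩, rfl⟩
    · rintro ⟨v, -, ⟨rfl, rfl⟩, rfl⟩
      exact ⟨rfl, rfl⟩
  | cons x w ih =>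
    obtain ⟨i, g⟩ := x
    simp only [width] at h
    split_ifs at h with hc
    have hu : u = u.take i ++ ((u.drop i).take (source g).length ++
        u.drop (i + (source g).length)) := by
      rw [← List.drop_drop, List.take_append_drop, List.take_append_drop]
    have step : ∀ {v : List Bool} {c : Bool},
        (v, c) ∈ pieceColourings g ((u.drop i).take (source g).length) →
        width w (u.take i ++ v ++ u.drop (i + (source g).length)).length = some n := by
      intro v c hv
      rw [← h]
      congr 1
      have := (length_of_mem_pieceColourings hv).2
      simp only [List.length_append, List.length_take, List.length_drop, this]
      omega
    simp only [Colouring, colourings, List.mem_flatMap, List.mem_map, Prod.mk.injEq, Prod.exists]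
    constructor
    · rintro ⟨p, u', v, q, c, hp, hs, hv, hw⟩
      rw [hu, Stream'.append_append_stream, Stream'.append_append_stream] at hs
      obtain ⟨rfl, hs'⟩ := appendStream_inj (by simp; omega) hs
      have hu' := (length_of_mem_pieceColourings hv).1
      obtain ⟨rfl, rfl⟩ := appendStream_inj (by simp; omega) hs'
      rw [← Stream'.append_append_stream, ← Stream'.append_append_stream, ih (step hv)] at hw
      obtain ⟨t', ht', hm, rfl⟩ := hw
      exact ⟨t', ht', ⟨v, c, hv, t', _, hm, rfl, by simp⟩, rfl⟩
    · rintro ⟨t', ht', ⟨v, c, hv, _, b', hm, rfl, rfl⟩, rfl⟩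
      refine ⟨u.take i, _, v, u.drop (i + (source g).length) ++ₛ τ, c, by simp; omega, ?_, hv, ?_⟩
      · conv_lhs => rw [hu]
        rw [Stream'.append_append_stream, Stream'.append_append_stream]
      · rw [← Stream'.append_append_stream, ← Stream'.append_append_stream, ih (step hv)]
        exact ⟨_, ht', by simpa using hm, rfl⟩

theorem colouring_append_word (w w' : Word LinkPiece) (s t : Stream' Bool) (b : Bool) :
    Colouring (w ++ w') s t b ↔ ∃ (r : Stream' Bool) (c : Bool),
      Colouring w s r c ∧ Colouring w' r t (b ^^ c) := by
  induction w generalizing s b with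
  | nil => simp [Colouring]
  | cons x w ih =>
    obtain ⟨i, g⟩ := x
    simp only [List.cons_append, Colouring, ih]
    constructor
    · rintro ⟨p, u, v, q, c, hp, hs, hv, r, d, h1, h2⟩
      refine ⟨r, d ^^ c, ⟨p, u, v, q, c, hp, hs, hv, by simpa using h1⟩, ?_⟩
      rwa [Bool.xor_comm d c, ← Bool.xor_assoc]
    · rintro ⟨r, d, ⟨p, u, v, q, c, hp, hs, hv, h1⟩, h2⟩
      refine ⟨p, u, v, q, c, hp, hs, hv, r, d ^^ c, h1, ?_⟩
      have e : ((b ^^ c) ^^ (d ^^ c)) = (b ^^ d) := by cases b <;> cases c <;> cases d <;> rfl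
      rwa [e]

/-- Strands to the left of a word keep their colours. -/
theorem colouring_shift_append (w : Word LinkPiece) {k : ℕ} {p : List Bool} (hp : p.length = k)
    (s t : Stream' Bool) (b : Bool) :
    Colouring (shift k w) (p ++ₛ s) t b ↔ ∃ t', t = p ++ₛ t' ∧ Colouring w s t' b := by
  induction w generalizing s b with
  | nil =>
    simp only [shift, List.map_nil, Colouring]
    constructor
    · rintro ⟨rfl, rfl⟩
      exact ⟨s, rfl, rfl, rfl⟩
    · rintro ⟨t', rfl, rfl, rfl⟩
      exact ⟨rfl, rfl⟩
  | cons x w ih =>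
    obtain ⟨i, g⟩ := x
    simp only [shift, List.map_cons, Colouring] at ih ⊢
    constructor
    · rintro ⟨p', u, v, q, c, hp', hs, hv, h⟩
      have e : p' = p'.take k ++ p'.drop k := (List.take_append_drop _ _).symm
      rw [e, Stream'.append_append_stream] at hs h
      obtain ⟨hk, rfl⟩ := appendStream_inj (by simp; omega) hs
      rw [← hk, ih] at h
      obtain ⟨t', rfl, h⟩ := h
      exact ⟨t', rfl, p'.drop k, u, v, q, c, by simp; omega, rfl, hv, h⟩
    · rintro ⟨t', rfl, p', u, v, q, c, hp', rfl, hv, h⟩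
      refine ⟨p ++ p', u, v, q, c, by simp; omega, ?_, hv, ?_⟩
      · rw [Stream'.append_append_stream]
      · rw [Stream'.append_append_stream, ih]
        exact ⟨t', rfl, h⟩

/-- Two words have the same two-colourings, as far as the ends and the parity are concerned. -/
def ColourEquiv (a b : Word LinkPiece) : Prop := ∀ s t c, Colouring a s t c ↔ Colouring b s t c

theorem ColourEquiv.shift {a b : Word LinkPiece} (h : ColourEquiv a b) (k : ℕ) :
    ColourEquiv (shift k a) (shift k b) := by
  intro s t c
  obtain ⟨p, s, hp, rfl⟩ := exists_appendStream k s
  simp only [colouring_shift_append _ hp, h s _ c]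

theorem ColourEquiv.context {a b : Word LinkPiece} (h : ColourEquiv a b)
    (pre post : Word LinkPiece) : ColourEquiv (pre ++ a ++ post) (pre ++ b ++ post) := by
  intro s t c
  simp only [colouring_append_word, h _ _ _]

/-! ### Symbolic computation of two-colourings -/

/-- A symbolic description of the two-colourings of a word.  The ends of the word carry labels, equal
labels for ends of the same component, and a colouring is a map from labels to colours.  The list
`poly` of pairs of labels is a polynomial over the field with two elements, the sum of the products of
the colours in each pair; it gives the parity.  All labels in use are below `next`. -/
structure SymbolicColouring where
  bottom : List ℕ
  top : List ℕ
  poly : List (ℕ × ℕ)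
  next : ℕ

/-- The value of a polynomial at a colouring of the labels. -/
def polyValue (f : ℕ → Bool) : List (ℕ × ℕ) → Bool
  | [] => false
  | m :: P => (f m.1 && f m.2) ^^ polyValue f P

/-- The bottom colours, top colours and parity that come from a colouring of the labels. -/
def SymbolicColouring.Realizes (S : SymbolicColouring) (u v : List Bool) (b : Bool) : Prop :=
  ∃ f : ℕ → Bool, u = S.bottom.map f ∧ v = S.top.map f ∧ b = polyValue f S.poly

/-- All labels are below `next`, so that `next` is a fresh label. -/
def SymbolicColouring.Fresh (S : SymbolicColouring) : Prop :=
  (∀ x ∈ S.bottom, x < S.next) ∧ (∀ x ∈ S.top, x < S.next) ∧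
    ∀ m ∈ S.poly, m.1 < S.next ∧ m.2 < S.next

/-- Apply a map to all labels of a polynomial. -/
def relabel (φ : ℕ → ℕ) (P : List (ℕ × ℕ)) : List (ℕ × ℕ) := P.map fun m => (φ m.1, φ m.2)

/-- Putting an elementary piece on top: a cup has a fresh label, a cap identifies two labels, and the
crossing of `x` over `y` contributes `x * (1 + y) = x * x + x * y` to the parity. -/
def SymbolicColouring.extend (S : SymbolicColouring) (i : ℕ) (g : LinkPiece) : SymbolicColouring :=
  match g, S.top.drop i with
  | .cup, r => ⟨S.bottom, S.top.take i ++ S.next :: S.next :: r, S.poly, S.next + 1⟩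
  | .cap, x :: y :: r =>
      let φ := fun z => if z = y then x else z
      ⟨S.bottom.map φ, (S.top.take i ++ r).map φ, relabel φ S.poly, S.next⟩
  | .cross s, x :: y :: r =>
      let z := bif s then x else y
      ⟨S.bottom, S.top.take i ++ y :: x :: r, (z, z) :: (x, y) :: S.poly, S.next⟩
  | _, _ => S

/-- Putting a word on top. -/
def SymbolicColouring.extendWord (S : SymbolicColouring) : Word LinkPiece → SymbolicColouring
  | [] => S
  | (i, g) :: w => (S.extend i g).extendWord w

/-- The symbolic description of the colourings of a word with `m` ends at the bottom. -/
def symbolicColouring (m : ℕ) (w : Word LinkPiece) : SymbolicColouring :=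
  SymbolicColouring.extendWord ⟨List.range m, List.range m, [], m⟩ w

theorem polyValue_append (f : ℕ → Bool) (P Q : List (ℕ × ℕ)) :
    polyValue f (P ++ Q) = (polyValue f P ^^ polyValue f Q) := by
  induction P with
  | nil => simp [polyValue]
  | cons m P ih => simp [polyValue, ih]

theorem polyValue_relabel (f : ℕ → Bool) (φ : ℕ → ℕ) (P : List (ℕ × ℕ)) :
    polyValue f (relabel φ P) = polyValue (f ∘ φ) P := by
  induction P with
  | nil => rfl
  | cons m P ih => simp_all [polyValue, relabel]

theorem polyValue_congr {f f' : ℕ → Bool} {P : List (ℕ × ℕ)}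
    (h : ∀ m ∈ P, f m.1 = f' m.1 ∧ f m.2 = f' m.2) : polyValue f P = polyValue f' P := by
  induction P with
  | nil => rfl
  | cons m P ih => simp_all [polyValue]

theorem SymbolicColouring.Fresh.extend {S : SymbolicColouring} (h : S.Fresh) (i : ℕ)
    (g : LinkPiece) : (S.extend i g).Fresh := by
  obtain ⟨B, T, P, n⟩ := S
  obtain ⟨hB, hT, hP⟩ := h
  simp only at hB hT hP
  have ht : ∀ x ∈ T.take i, x < n := fun x hx => hT x (List.mem_of_mem_take hx)
  have hd : ∀ x ∈ T.drop i, x < n := fun x hx => hT x (List.mem_of_mem_drop hx)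
  unfold SymbolicColouring.extend
  rcases g with _ | _ | s <;> simp only
  · refine ⟨fun x hx => (hB x hx).trans (Nat.lt_succ_self n), fun x hx => ?_,
      fun m hm => ⟨(hP m hm).1.trans (Nat.lt_succ_self n), (hP m hm).2.trans (Nat.lt_succ_self n)⟩⟩
    simp only [List.mem_append, List.mem_cons] at hx
    rcases hx with hx | rfl | rfl | hx
    · exact (ht x hx).trans (Nat.lt_succ_self n)
    · exact Nat.lt_succ_self _
    · exact Nat.lt_succ_self _
    · exact (hd x hx).trans (Nat.lt_succ_self n)
  · rcases hr : T.drop i with _ | ⟨x, _ | ⟨y, r⟩⟩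
    · exact ⟨hB, hT, hP⟩
    · exact ⟨hB, hT, hP⟩
    · simp only [hr, List.mem_cons, forall_eq_or_imp] at hd
      have hφ : ∀ z, z < n → (if z = y then x else z) < n := by
        intro z hz
        split_ifs
        exacts [hd.1, hz]
      refine ⟨fun z' hz' => ?_, fun z' hz' => ?_, fun m' hm' => ?_⟩
      · obtain ⟨z, hz, rfl⟩ := List.mem_map.1 hz'
        exact hφ z (hB z hz)
      · obtain ⟨z, hz, rfl⟩ := List.mem_map.1 hz'
        exact hφ z ((List.mem_append.1 hz).elim (ht z) (hd.2.2 z))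
      · obtain ⟨m, hm, rfl⟩ := List.mem_map.1 hm'
        exact ⟨hφ _ (hP m hm).1, hφ _ (hP m hm).2⟩
  · rcases hr : T.drop i with _ | ⟨x, _ | ⟨y, r⟩⟩
    · exact ⟨hB, hT, hP⟩
    · exact ⟨hB, hT, hP⟩
    · simp only [hr, List.mem_cons, forall_eq_or_imp] at hd
      refine ⟨hB, fun z hz => ?_, fun m hm => ?_⟩
      · simp only [List.mem_append, List.mem_cons] at hz
        rcases hz with hz | rfl | rfl | hz
        exacts [ht z hz, hd.2.1, hd.1, hd.2.2 z hz]
      · simp only [List.mem_cons] at hm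
        rcases hm with rfl | rfl | hm
        · cases s
          exacts [⟨hd.2.1, hd.2.1⟩, ⟨hd.1, hd.1⟩]
        · exact ⟨hd.1, hd.2.1⟩
        · exact hP m hm

/-- Symbolic and actual colourings extend over an elementary piece in the same way. -/
theorem SymbolicColouring.realizes_extend {S : SymbolicColouring} (h : S.Fresh) {i : ℕ}
    {g : LinkPiece} (hi : i + (source g).length ≤ S.top.length) (u v' : List Bool) (b : Bool) :
    (S.extend i g).Realizes u v' b ↔ ∃ (v x : List Bool) (c : Bool),
      S.Realizes u v (b ^^ c) ∧ (x, c) ∈ pieceColourings g ((v.drop i).take (source g).length) ∧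
        v' = v.take i ++ x ++ v.drop (i + (source g).length) := by
  obtain ⟨B, T, P, n⟩ := S
  obtain ⟨hB, hT, hP⟩ := h
  simp only at hB hT hP hi
  have e2 : ∀ {x y : ℕ} {r : List ℕ}, T.drop i = x :: y :: r → T.drop (i + 2) = r := by
    intro x y r hr
    rw [← List.drop_drop, hr]
    rfl
  unfold SymbolicColouring.extend SymbolicColouring.Realizes
  rcases g with _ | _ | s
  · simp only [source, List.length_nil, Nat.add_zero, List.take_zero, pieceColourings,
      List.mem_cons, List.not_mem_nil, or_false, Prod.mk.injEq]
    constructor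
    · rintro ⟨f, rfl, rfl, rfl⟩
      refine ⟨T.map f, [f n, f n], false, ⟨f, rfl, rfl, by simp⟩, ?_, by simp⟩
      cases f n <;> simp
    · rintro ⟨_, x, c, ⟨f, rfl, rfl, hb⟩, hx, rfl⟩
      -- the fresh label gets the colour of the cup
      have key : ∀ c : Bool, ∃ f' : ℕ → Bool, f' n = c ∧ ∀ z < n, f z = f' z := fun c =>
        ⟨Function.update f n c, by simp, fun z hz => by simp [Function.update_of_ne hz.ne]⟩
      obtain ⟨f', hn, hf⟩ := key (x.headD false)
      refine ⟨f', List.map_congr_left fun z hz => hf z (hB z hz), ?_, ?_⟩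
      · rw [List.map_append, List.map_cons, List.map_cons, hn, List.map_take, List.map_drop,
          ← List.map_congr_left fun z hz => hf z (hT z hz)]
        rcases hx with ⟨rfl, -⟩ | ⟨rfl, -⟩ <;> simp
      · rw [← polyValue_congr fun m hm => ⟨hf _ (hP m hm).1, hf _ (hP m hm).2⟩, ← hb]
        rcases hx with ⟨-, rfl⟩ | ⟨-, rfl⟩ <;> simp
  · simp only [source, List.length_cons, List.length_nil, Nat.zero_add] at hi ⊢
    rcases hr : T.drop i with _ | ⟨x, _ | ⟨y, r⟩⟩
    · have := congrArg List.length hr; simp at this; omega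
    · have := congrArg List.length hr; simp at this; omega
    · have e := e2 hr
      simp only
      constructor
      · rintro ⟨f, rfl, rfl, rfl⟩
        set φ := fun z => if z = y then x else z
        have hφ : f (φ x) = f (φ y) := by simp [φ]
        refine ⟨T.map (f ∘ φ), [], false, ⟨f ∘ φ, by simp, rfl, ?_⟩, ?_, ?_⟩
        · rw [polyValue_relabel]; simp
        · rw [← List.map_drop, hr]
          simp [pieceColourings, hφ]
        · rw [← List.map_take, ← List.map_drop, e]
          simp
      · rintro ⟨_, x', c, ⟨f, rfl, rfl, hb⟩, hx, rfl⟩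
        rw [← List.map_drop, hr] at hx
        simp only [List.map_cons, List.take_succ_cons, List.take_zero, pieceColourings] at hx
        split_ifs at hx with hxy
        · simp only [List.mem_singleton, Prod.mk.injEq] at hx
          obtain ⟨rfl, rfl⟩ := hx
          have hφ : f ∘ (fun z => if z = y then x else z) = f := by
            funext z
            by_cases hz : z = y <;> simp [hz, hxy]
          refine ⟨f, by rw [List.map_map, hφ], ?_, ?_⟩
          · rw [List.map_map, hφ, ← List.map_take, ← List.map_drop, e]
            simp
          · rw [polyValue_relabel, hφ, ← hb, Bool.xor_false]
        · simp at hx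
  · simp only [source, List.length_cons, List.length_nil, Nat.zero_add] at hi ⊢
    rcases hr : T.drop i with _ | ⟨x, _ | ⟨y, r⟩⟩
    · have := congrArg List.length hr; simp at this; omega
    · have := congrArg List.length hr; simp at this; omega
    · have e := e2 hr
      have val : ∀ f : ℕ → Bool, polyValue f (((bif s then x else y), (bif s then x else y)) ::
          (x, y) :: P) = (polyValue f P ^^ (bif s then f x && !f y else f y && !f x)) := by
        intro f
        simp only [polyValue]
        cases s <;> simp only [cond_true, cond_false] <;> cases f x <;> cases f y <;>
          cases polyValue f P <;> rfl
      simp only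
      constructor
      · rintro ⟨f, rfl, rfl, rfl⟩
        refine ⟨T.map f, [f y, f x], bif s then f x && !f y else f y && !f x,
          ⟨f, rfl, rfl, ?_⟩, ?_, ?_⟩
        · rw [val, Bool.xor_assoc, Bool.xor_self, Bool.xor_false]
        · rw [← List.map_drop, hr]
          simp [pieceColourings]
        · rw [← List.map_take, ← List.map_drop, e]
          simp
      · rintro ⟨_, x', c, ⟨f, rfl, rfl, hb⟩, hx, rfl⟩
        rw [← List.map_drop, hr] at hx
        simp only [List.map_cons, List.take_succ_cons, List.take_zero, pieceColourings,
          List.mem_singleton, Prod.mk.injEq] at hx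
        obtain ⟨rfl, rfl⟩ := hx
        refine ⟨f, rfl, ?_, ?_⟩
        · rw [← List.map_take, ← List.map_drop, e]
          simp
        · rw [val, ← hb, Bool.xor_assoc, Bool.xor_self, Bool.xor_false]

theorem SymbolicColouring.realizes_extendWord (w : Word LinkPiece) {S : SymbolicColouring}
    (h : S.Fresh) {n : ℕ} (hw : width w S.top.length = some n) (u v : List Bool) (b : Bool) :
    (S.extendWord w).Realizes u v b ↔
      ∃ (s : List Bool) (c : Bool), S.Realizes u s c ∧ (v, b ^^ c) ∈ colourings w s := by
  induction w generalizing S with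
  | nil =>
    simp only [SymbolicColouring.extendWord, colourings, List.mem_singleton, Prod.mk.injEq]
    constructor
    · exact fun H => ⟨v, b, H, rfl, Bool.xor_self b⟩
    · rintro ⟨s, c, H, rfl, hb⟩
      obtain rfl : b = c := by simpa using hb
      exact H
  | cons x w ih =>
    obtain ⟨i, g⟩ := x
    simp only [width] at hw
    split_ifs at hw with hc
    have hl : (S.extend i g).top.length = S.top.length - (source g).length + (target g).length := by
      unfold SymbolicColouring.extend
      rcases g with _ | _ | s
      · simp [source, target] at hc ⊢
        omega
      all_goals
        rcases hr : S.top.drop i with _ | ⟨x, _ | ⟨y, r⟩⟩ <;>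
          have := congrArg List.length hr <;> simp [source, target] at this hc ⊢ <;> omega
    rw [SymbolicColouring.extendWord, ih (h.extend i g) (by rw [hl, hw])]
    simp only [realizes_extend h hc, colourings, List.mem_flatMap, List.mem_map, Prod.mk.injEq,
      Prod.exists]
    constructor
    · rintro ⟨_, c, ⟨s, x, d, hS, hx, rfl⟩, hv⟩
      exact ⟨s, _, hS, x, d, hx, v, _, hv, rfl, by rw [Bool.xor_assoc]⟩
    · rintro ⟨s, c, hS, x, d, hx, _, b', hv, rfl, hb⟩
      refine ⟨_, c ^^ d, ⟨s, x, d, ?_, hx, rfl⟩, ?_⟩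
      · rwa [Bool.xor_assoc, Bool.xor_self, Bool.xor_false]
      · rwa [← Bool.xor_assoc, ← hb, Bool.xor_assoc, Bool.xor_self, Bool.xor_false]

/-- The symbolic description is correct. -/
theorem realizes_symbolicColouring {w : Word LinkPiece} {m n : ℕ} (hw : width w m = some n)
    {u : List Bool} (hu : u.length = m) (v : List Bool) (b : Bool) :
    (symbolicColouring m w).Realizes u v b ↔ (v, b) ∈ colourings w u := by
  rw [symbolicColouring, SymbolicColouring.realizes_extendWord w (n := n)
    ⟨by simp, by simp, by simp⟩ (by simpa using hw)]
  constructor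
  · rintro ⟨_, _, ⟨f, rfl, rfl, rfl⟩, h⟩
    simpa [polyValue] using h
  · intro h
    refine ⟨u, false, ⟨fun x => u.getD x false, ?_, ?_, rfl⟩, by simpa using h⟩ <;>
    · refine List.ext_getElem (by simpa using hu) fun j h1 h2 => ?_
      simp [h1]

/-- Add a monomial to a polynomial over the field with two elements without repeated monomials. -/
def toggle (m : ℕ × ℕ) : List (ℕ × ℕ) → List (ℕ × ℕ)
  | [] => [m]
  | m' :: P => if m = m' then P else m' :: toggle m P

/-- Write the monomials with increasing labels, and cancel equal ones. -/
def reducePoly : List (ℕ × ℕ) → List (ℕ × ℕ)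
  | [] => []
  | m :: P => toggle (min m.1 m.2, max m.1 m.2) (reducePoly P)

theorem polyValue_toggle (f : ℕ → Bool) (m : ℕ × ℕ) (P : List (ℕ × ℕ)) :
    polyValue f (toggle m P) = ((f m.1 && f m.2) ^^ polyValue f P) := by
  induction P with
  | nil => rfl
  | cons m' P ih =>
    simp only [toggle]
    split_ifs with h
    · simp [h, polyValue]
    · simp [polyValue, ih, Bool.xor_left_comm]

theorem polyValue_reducePoly (f : ℕ → Bool) (P : List (ℕ × ℕ)) :
    polyValue f (reducePoly P) = polyValue f P := by
  induction P with
  | nil => rfl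
  | cons m P ih =>
    rw [reducePoly, polyValue_toggle, ih, polyValue]
    rcases le_total m.1 m.2 with h | h <;> simp [h, Bool.and_comm]

/-- A check that the colourings described by `S` are also described by `S'`: renaming the labels of
`S'` gives those of `S` at the same ends, and then the polynomials agree. -/
def SymbolicColouring.included (S S' : SymbolicColouring) : Bool :=
  let φ := fun z => (S.bottom ++ S.top).getD ((S'.bottom ++ S'.top).idxOf z) 0
  S'.bottom.map φ == S.bottom && S'.top.map φ == S.top &&
    (reducePoly (relabel φ S'.poly ++ S.poly)).isEmpty

theorem SymbolicColouring.realizes_of_included {S S' : SymbolicColouring}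
    (h : S.included S' = true) {u v : List Bool} {b : Bool} (hS : S.Realizes u v b) :
    S'.Realizes u v b := by
  simp only [SymbolicColouring.included, Bool.and_eq_true, beq_iff_eq, List.isEmpty_iff] at h
  obtain ⟨⟨h1, h2⟩, h3⟩ := h
  obtain ⟨f, rfl, rfl, rfl⟩ := hS
  set φ := fun z => (S.bottom ++ S.top).getD ((S'.bottom ++ S'.top).idxOf z) 0
  refine ⟨f ∘ φ, ?_, ?_, ?_⟩
  · rw [← List.map_map, h1]
  · rw [← List.map_map, h2]
  · have := polyValue_reducePoly f (relabel φ S'.poly ++ S.poly)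
    rw [h3, polyValue_append, polyValue_relabel] at this
    revert this
    simp only [polyValue]
    cases polyValue f S.poly <;> cases polyValue (f ∘ φ) S'.poly <;> simp

/-- A check of the equivalence of two words with `m` ends at the bottom and `n` ends at the top. -/
def equivCheck (m n : ℕ) (a b : Word LinkPiece) : Bool :=
  width a m == some n && width b m == some n &&
    (symbolicColouring m a).included (symbolicColouring m b) &&
    (symbolicColouring m b).included (symbolicColouring m a)

theorem colourEquiv_of_equivCheck {a b : Word LinkPiece} (m n : ℕ)
    (h : equivCheck m n a b = true) : ColourEquiv a b := by
  simp only [equivCheck, Bool.and_eq_true, beq_iff_eq] at h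
  obtain ⟨⟨⟨ha, hb⟩, hab⟩, hba⟩ := h
  intro s t c
  obtain ⟨u, s, hu, rfl⟩ := exists_appendStream m s
  rw [colouring_append_iff a (by rw [hu, ha]), colouring_append_iff b (by rw [hu, hb])]
  simp only [← realizes_symbolicColouring ha hu, ← realizes_symbolicColouring hb hu]
  exact exists_congr fun v => and_congr_right fun _ => and_congr_left fun _ =>
    ⟨SymbolicColouring.realizes_of_included hab, SymbolicColouring.realizes_of_included hba⟩

/-! ### Two-colourings and moves of links -/

/-- Words beside each other commute. -/
theorem colourEquiv_far (a b : Word LinkPiece) {m n : ℕ} (ha : width a m = some n) (k : ℕ) :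
    ColourEquiv (a ++ shift (n + k) b) (shift (m + k) b ++ a) := by
  intro s t c
  obtain ⟨u, s, rfl, rfl⟩ := exists_appendStream m s
  obtain ⟨z, s, rfl, rfl⟩ := exists_appendStream k s
  simp only [colouring_append_word]
  constructor
  · rintro ⟨r, d, h1, h2⟩
    obtain ⟨v, rfl, hv, rfl⟩ := (colouring_append_iff a ha _ _ _).1 h1
    rw [← Stream'.append_append_stream, colouring_shift_append b (by simp)] at h2
    obtain ⟨t, rfl, h2⟩ := h2
    rw [← Stream'.append_append_stream]
    refine ⟨(u ++ z) ++ₛ t, c ^^ d, ?_, ?_⟩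
    · rw [colouring_shift_append b (by simp)]
      exact ⟨t, rfl, h2⟩
    · rw [Stream'.append_append_stream, Stream'.append_append_stream, colouring_append_iff a ha]
      exact ⟨v, rfl, by simpa using hv, rfl⟩
  · rintro ⟨r, d, h1, h2⟩
    rw [← Stream'.append_append_stream, colouring_shift_append b (by simp)] at h1
    obtain ⟨t', rfl, h1⟩ := h1
    rw [Stream'.append_append_stream, colouring_append_iff a ha] at h2
    obtain ⟨v, rfl, hv, rfl⟩ := h2
    refine ⟨v ++ₛ (z ++ₛ s), c ^^ d, ?_, ?_⟩
    · rw [colouring_append_iff a ha]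
      exact ⟨v, rfl, hv, rfl⟩
    · rw [← Stream'.append_append_stream, ← Stream'.append_append_stream,
        colouring_shift_append b (by simp)]
      exact ⟨t', rfl, by simpa using h1⟩

/-- Some two-colouring of the closed diagram has an odd number of crossings at which a strand
coloured `true` passes over a strand coloured `false`; in other words, some part of the link has an odd
linking number with the rest. -/
def OddColouring (w : Word LinkPiece) : Prop :=
  Colouring w (Stream'.const false) (Stream'.const false) true

theorem not_oddColouring_nil : ¬ OddColouring [] := by simp [OddColouring, Colouring]

theorem oddColouring_of_realizes {w : Word LinkPiece} (h : width w 0 = some 0)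
    (hw : (symbolicColouring 0 w).Realizes [] [] true) : OddColouring w :=
  (colouring_append_iff w (u := []) h _ _ _).2
    ⟨[], rfl, (realizes_symbolicColouring h rfl _ _).1 hw, rfl⟩

theorem colourEquiv_of_linkMove {a b : Word LinkPiece} (h : LinkMove a b) : ColourEquiv a b := by
  cases h with
  | far x y k =>
    exact colourEquiv_far [(0, x)] [(0, y)] (m := (source x).length) (n := (target x).length)
      (by simp [width]) k
  | zigzag₁ => exact colourEquiv_of_equivCheck 1 1 (by decide)
  | zigzag₂ => exact colourEquiv_of_equivCheck 1 1 (by decide)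
  | capSwing s => cases s <;> exact colourEquiv_of_equivCheck 3 1 (by decide)
  | cupSwing s => cases s <;> exact colourEquiv_of_equivCheck 1 3 (by decide)
  | RI₁ s => cases s <;> exact colourEquiv_of_equivCheck 1 1 (by decide)
  | RI₂ s => cases s <;> exact colourEquiv_of_equivCheck 1 1 (by decide)
  | RII s => cases s <;> exact colourEquiv_of_equivCheck 2 2 (by decide)
  | RIII s s' s'' h =>
    revert h
    cases s <;> cases s' <;> cases s'' <;> intro h <;> first
      | exact absurd (h rfl) (by decide)
      | exact colourEquiv_of_equivCheck 3 3 (by decide)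

theorem colourEquiv_of_circleDeletion {a b : Word LinkPiece} (h : CircleDeletion a b) :
    ColourEquiv a b := by
  cases h
  exact colourEquiv_of_equivCheck 0 0 (by decide)

/-- Whether a link has an odd two-colouring does not change when unlinked unknotted components are
removed. -/
def ReducedLink.Odd : ReducedLink → Prop :=
  Quot.lift (fun K => OddColouring K.1) fun K K' h => by
    obtain ⟨pre, post, a, b, k, hab, h1, h2⟩ := h
    rw [h1, h2]
    exact propext (((hab.elim colourEquiv_of_linkMove colourEquiv_of_circleDeletion).shift k).context
      pre post _ _ _)

/-! ### Two-colourings and moves of framed graphs -/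

theorem threeLineWord_append (w w' : Word GraphPiece) :
    threeLineWord (w ++ w') = threeLineWord w ++ threeLineWord w' :=
  List.flatMap_append

theorem shift_shift {G : Type} (k l : ℕ) (w : Word G) : shift k (shift l w) = shift (k + l) w := by
  simp [shift, Nat.add_assoc]

theorem threeLineWord_shift (k : ℕ) (w : Word GraphPiece) :
    threeLineWord (shift k w) = shift (3 * k) (threeLineWord w) := by
  induction w with
  | nil => rfl
  | cons x w ih =>
    have h : threeLineWord (shift k (x :: w)) =
        shift (3 * (k + x.1)) (threeLinePiece x.2) ++ threeLineWord (shift k w) := rfl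
    rw [h, ih, Nat.mul_add, ← shift_shift]
    simp [threeLineWord, shift]

theorem width_threeLinePiece (g : GraphPiece) :
    width (threeLinePiece g) (3 * (source g).length) = some (3 * (target g).length) := by
  cases g with
  | cup t => rfl
  | cap t => rfl
  | cross t u s => rfl
  | vertex s => rfl
  | twist t b => cases t <;> cases b <;> rfl

theorem colourEquiv_of_isotopyMove {a b : Word GraphPiece} (h : IsotopyMove a b) :
    ColourEquiv (threeLineWord a) (threeLineWord b) := by
  cases h with
  | far x y k =>
    have := colourEquiv_far (threeLinePiece x) (threeLinePiece y) (width_threeLinePiece x) (3 * k)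
    rw [← Nat.mul_add, ← Nat.mul_add] at this
    simpa [threeLineWord, shift] using this
  | zigzag₁ t =>
    simp only [threeLineWord, List.flatMap_cons, List.flatMap_nil, threeLinePiece]
    exact colourEquiv_of_equivCheck 3 3 (by decide +kernel)
  | zigzag₂ t =>
    simp only [threeLineWord, List.flatMap_cons, List.flatMap_nil, threeLinePiece]
    exact colourEquiv_of_equivCheck 3 3 (by decide +kernel)
  | crossCap t u s =>
    simp only [threeLineWord, List.flatMap_cons, List.flatMap_nil, threeLinePiece]
    cases s <;>
      exact colourEquiv_of_equivCheck 9 3 (by decide +kernel)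
  | crossCup t u s =>
    simp only [threeLineWord, List.flatMap_cons, List.flatMap_nil, threeLinePiece]
    cases s <;>
      exact colourEquiv_of_equivCheck 3 9 (by decide +kernel)
  | vertexCap s =>
    simp only [threeLineWord, List.flatMap_cons, List.flatMap_nil, threeLinePiece]
    cases s <;>
      exact colourEquiv_of_equivCheck 9 3 (by decide +kernel)
  | vertexCup s =>
    simp only [threeLineWord, List.flatMap_cons, List.flatMap_nil, threeLinePiece]
    cases s <;>
      exact colourEquiv_of_equivCheck 3 9 (by decide +kernel)
  | twistCancel t b =>
    simp only [threeLineWord, List.flatMap_cons, List.flatMap_nil, threeLinePiece]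
    cases t <;> cases b <;>
      exact colourEquiv_of_equivCheck 3 3 (by decide +kernel)
  | twistCap t b =>
    simp only [threeLineWord, List.flatMap_cons, List.flatMap_nil, threeLinePiece]
    cases t <;> cases b <;>
      exact colourEquiv_of_equivCheck 6 0 (by decide +kernel)
  | twistCup t b =>
    simp only [threeLineWord, List.flatMap_cons, List.flatMap_nil, threeLinePiece]
    cases t <;> cases b <;>
      exact colourEquiv_of_equivCheck 0 6 (by decide +kernel)
  | twistCross₁ t u s b =>
    simp only [threeLineWord, List.flatMap_cons, List.flatMap_nil, threeLinePiece]
    cases t <;> cases b <;> cases s <;>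
      exact colourEquiv_of_equivCheck 6 6 (by decide +kernel)
  | twistCross₂ t u s b =>
    simp only [threeLineWord, List.flatMap_cons, List.flatMap_nil, threeLinePiece]
    cases u <;> cases b <;> cases s <;>
      exact colourEquiv_of_equivCheck 6 6 (by decide +kernel)
  | RI₁ t s =>
    cases t <;> cases s <;>
      exact colourEquiv_of_equivCheck 3 3 (by decide +kernel)
  | RI₂ t s =>
    cases t <;> cases s <;>
      exact colourEquiv_of_equivCheck 3 3 (by decide +kernel)
  | RII t u s =>
    simp only [threeLineWord, List.flatMap_cons, List.flatMap_nil, threeLinePiece]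
    cases s <;>
      exact colourEquiv_of_equivCheck 6 6 (by decide +kernel)
  | RIII t u v s s' s'' h =>
    simp only [threeLineWord, List.flatMap_cons, List.flatMap_nil, threeLinePiece]
    revert h
    cases s <;> cases s' <;> cases s'' <;> intro h <;> first
      | exact absurd (h rfl) (by decide)
      | exact colourEquiv_of_equivCheck 9 9 (by decide +kernel)
  | RIV₁ s t c =>
    simp only [threeLineWord, List.flatMap_cons, List.flatMap_nil, threeLinePiece]
    cases s <;> cases c <;>
      exact colourEquiv_of_equivCheck 9 9 (by decide +kernel)
  | RIV₂ s t c =>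
    simp only [threeLineWord, List.flatMap_cons, List.flatMap_nil, threeLinePiece]
    cases s <;> cases c <;>
      exact colourEquiv_of_equivCheck 9 9 (by decide +kernel)
  | RV s =>
    cases s <;> exact colourEquiv_of_equivCheck 6 6 (by decide +kernel)

theorem colourEquiv_of_pachnerMove {a b : Word GraphPiece} (h : PachnerMove a b) :
    ColourEquiv (threeLineWord a) (threeLineWord b) := by
  cases h with
  | move14 s =>
    cases s <;> exact colourEquiv_of_equivCheck 6 6 (by decide +kernel)
  | move23 s =>
    cases s <;> exact colourEquiv_of_equivCheck 9 9 (by decide +kernel)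

theorem oddColouring_iff_of_localStep {R : Word GraphPiece → Word GraphPiece → Prop}
    (hR : ∀ a b, R a b → ColourEquiv (threeLineWord a) (threeLineWord b)) {w w' : Word GraphPiece}
    (h : LocalStep R w w') :
    OddColouring (threeLineWord w) ↔ OddColouring (threeLineWord w') := by
  obtain ⟨pre, post, a, b, k, hab, rfl, rfl⟩ := h
  simp only [threeLineWord_append, threeLineWord_shift]
  exact ((hR a b hab).shift _).context _ _ _ _ _

/-- Whether the 3-line graph of a diagram has an odd two-colouring is an invariant of the framed
graph. -/
def FramedGraph.Odd : FramedGraph → Prop :=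
  Quot.lift (fun D => OddColouring (threeLineWord D.word)) fun _ _ h =>
    propext (oddColouring_iff_of_localStep (fun _ _ => colourEquiv_of_isotopyMove) h)

/-- The invariant is constant on the components of the Pachner graph. -/
theorem odd_iff_of_reachable {M : Type} [TopologicalSpace M]
    {a b : {g : FramedGraph // g.IsDualTo M}} (h : (pachnerGraph M).Reachable a b) :
    a.1.Odd ↔ b.1.Odd := by
  have step : ∀ {g h : FramedGraph}, (∃ D D' : GraphDiagram, D.graph = g ∧ D'.graph = h ∧
      LocalStep PachnerMove D.word D'.word) → (g.Odd ↔ h.Odd) := by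
    rintro _ _ ⟨D, D', rfl, rfl, h⟩
    exact oddColouring_iff_of_localStep (fun _ _ => colourEquiv_of_pachnerMove) h
  obtain ⟨p⟩ := h
  induction p with
  | nil => rfl
  | cons hadj _ ih =>
    rw [pachnerGraph, SimpleGraph.fromRel_adj] at hadj
    rcases hadj.2 with h | h
    · exact (step h).trans ih
    · exact (step h).symm.trans ih

theorem oddColouring_exampleWord_false : OddColouring (threeLineWord (exampleWord false)) :=
  oddColouring_of_realizes (by decide +kernel)
    ⟨fun z => z == 1, by decide +kernel, by decide +kernel, by decide +kernel⟩

/-! ### An explicit isotopy of links -/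

instance : DecidableEq LinkPiece := fun
  | .cup, .cup => isTrue rfl
  | .cap, .cap => isTrue rfl
  | .cross s, .cross s' => decidable_of_iff (s = s') (by simp)
  | .cup, .cap | .cup, .cross _ | .cap, .cup | .cap, .cross _ | .cross _, .cup | .cross _, .cap =>
    isFalse (by simp)

/-- Names of the moves that a deformation of a link diagram may use besides far commutations. -/
inductive Replacement
  | zigzag₁
  | zigzag₂
  | capSwing (s : Bool)
  | cupSwing (s : Bool)
  | RI₂ (s : Bool)
  | RII (s : Bool)
  | RIII (s s' : Bool)
  | circle

open LinkPiece in
/-- The words before and after a move. -/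
def Replacement.sides : Replacement → Word LinkPiece × Word LinkPiece
  | zigzag₁ => ([(0, cup), (1, cap)], [])
  | zigzag₂ => ([(1, cup), (0, cap)], [])
  | capSwing s => ([(0, cross s), (1, cap)], [(1, cross !s), (0, cap)])
  | cupSwing s => ([(1, cup), (0, cross s)], [(0, cup), (1, cross !s)])
  | RI₂ s => ([(0, cup), (1, cross s), (0, cap)], [])
  | RII s => ([(0, cross s), (0, cross !s)], [])
  | RIII s s' => ([(0, cross s), (1, cross s'), (0, cross !s)],
      [(1, cross !s), (0, cross s'), (1, cross s)])
  | circle => ([(0, cup), (0, cap)], [])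

/-- The moves under which a `ReducedLink` is invariant. -/
abbrev ReducedMove (a b : Word LinkPiece) : Prop := LinkMove a b ∨ CircleDeletion a b

theorem Replacement.reducedMove (r : Replacement) : ReducedMove r.sides.1 r.sides.2 := by
  cases r with
  | zigzag₁ => exact .inl .zigzag₁
  | zigzag₂ => exact .inl .zigzag₂
  | capSwing s => exact .inl (.capSwing s)
  | cupSwing s => exact .inl (.cupSwing s)
  | RI₂ s => exact .inl (.RI₂ s)
  | RII s => exact .inl (.RII s)
  | RIII s s' => exact .inl (.RIII s s' (!s) (by simp))
  | circle => exact .inr .circle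

/-- Replace the word `a`, which has to be found at the layers from `n` on, by the word `b`, provided
that the result is closed. -/
def replaceAt (n : ℕ) (a b w : Word LinkPiece) : Option (Word LinkPiece) :=
  if w.take n ++ a ++ w.drop (n + a.length) = w ∧
      run [] (w.take n ++ b ++ w.drop (n + a.length)) = some [] then
    some (w.take n ++ b ++ w.drop (n + a.length))
  else none

/-- Exchange the layers `n` and `n + 1`, if they are beside each other. -/
def commuteAt (n : ℕ) (w : Word LinkPiece) : Option (Word LinkPiece) :=
  match w.drop n with
  | (i, x) :: (j, y) :: _ =>
      if i + (target x).length ≤ j then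
        replaceAt n [(i, x), (j, y)] [(j - (target x).length + (source x).length, y), (i, x)] w
      else if j + (source y).length ≤ i then
        replaceAt n [(i, x), (j, y)] [(j, y), (i - (source y).length + (target y).length, x)] w
      else none
  | _ => none

/-- Instructions for the deformation of a link diagram.  `lower n m` moves layer `n` down to layer
`m`, and `raise n m` moves it up to layer `m`, past layers beside it.  `move n k r` applies the move
`r` at the layers from `n` on, with `k` strands to the left, and `unmove n k r` its inverse. -/
inductive Instruction
  | lower (n m : ℕ)
  | raise (n m : ℕ)
  | move (n k : ℕ) (r : Replacement)
  | unmove (n k : ℕ) (r : Replacement)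

/-- Exchange layers as listed. -/
def commuteAll : List ℕ → Word LinkPiece → Option (Word LinkPiece)
  | [], w => some w
  | n :: l, w => (commuteAt n w).bind (commuteAll l)

/-- Carry out an instruction; `none` if this is not possible. -/
def Instruction.apply : Instruction → Word LinkPiece → Option (Word LinkPiece)
  | lower n m, w => commuteAll ((List.range' m (n - m)).reverse) w
  | raise n m, w => commuteAll (List.range' n (m - n)) w
  | move n k r, w => replaceAt n (shift k r.sides.1) (shift k r.sides.2) w
  | unmove n k r, w => replaceAt n (shift k r.sides.2) (shift k r.sides.1) w

/-- If `w` is a link diagram, then so is `w'`, and they have the same reduced link. -/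
def SameReduced (w w' : Word LinkPiece) : Prop :=
  ∀ h : run [] w = some [], ∃ h' : run [] w' = some [],
    LinkDiagram.reduce ⟨w, h⟩ = LinkDiagram.reduce ⟨w', h'⟩

theorem SameReduced.trans {w w' w'' : Word LinkPiece} (h : SameReduced w w')
    (h' : SameReduced w' w'') : SameReduced w w'' := fun hw =>
  let ⟨hw', e⟩ := h hw
  let ⟨hw'', e'⟩ := h' hw'
  ⟨hw'', e.trans e'⟩

theorem sameReduced_of_replaceAt {n k : ℕ} {a b w w' : Word LinkPiece}
    (h : ReducedMove a b ∨ ReducedMove b a)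
    (hw : replaceAt n (shift k a) (shift k b) w = some w') : SameReduced w w' := by
  unfold replaceAt at hw
  split_ifs at hw with hc
  obtain rfl := Option.some.inj hw
  refine fun _ => ⟨hc.2, ?_⟩
  rcases h with h | h
  · exact Quot.sound ⟨_, _, a, b, k, h, hc.1.symm, rfl⟩
  · exact (Quot.sound ⟨_, _, b, a, k, h, rfl, hc.1.symm⟩).symm

theorem sameReduced_of_commuteAt {n : ℕ} {w w' : Word LinkPiece} (h : commuteAt n w = some w') :
    SameReduced w w' := by
  unfold commuteAt at h
  split at h
  · rename_i i x j y r _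
    split_ifs at h with h1 h2
    · obtain ⟨k, rfl⟩ := Nat.exists_eq_add_of_le h1
      refine sameReduced_of_replaceAt (n := n) (k := i) (.inl (.inl (.far x y k))) ?_
      rw [← h]
      congr 1 <;> simp [shift] <;> omega
    · obtain ⟨k, rfl⟩ := Nat.exists_eq_add_of_le h2
      refine sameReduced_of_replaceAt (n := n) (k := j) (.inr (.inl (.far y x k))) ?_
      rw [← h]
      congr 1 <;> simp [shift] <;> omega
  · cases h

theorem sameReduced_of_commuteAll {l : List ℕ} {w w' : Word LinkPiece}
    (h : commuteAll l w = some w') : SameReduced w w' := by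
  induction l generalizing w with
  | nil =>
    obtain rfl := Option.some.inj h
    exact fun hw => ⟨hw, rfl⟩
  | cons n l ih =>
    obtain ⟨v, hv, h⟩ := Option.bind_eq_some_iff.1 h
    exact (sameReduced_of_commuteAt hv).trans (ih h)

theorem sameReduced_of_apply {I : Instruction} {w w' : Word LinkPiece}
    (h : I.apply w = some w') : SameReduced w w' := by
  cases I with
  | lower n m => exact sameReduced_of_commuteAll h
  | raise n m => exact sameReduced_of_commuteAll h
  | move n k r => exact sameReduced_of_replaceAt (.inl r.reducedMove) h
  | unmove n k r => exact sameReduced_of_replaceAt (.inr r.reducedMove) h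

/-- Carry out instructions one after the other. -/
def applyAll : List Instruction → Word LinkPiece → Option (Word LinkPiece)
  | [], w => some w
  | I :: L, w => (I.apply w).bind (applyAll L)

theorem sameReduced_of_applyAll {L : List Instruction} {w w' : Word LinkPiece}
    (h : applyAll L w = some w') : SameReduced w w' := by
  induction L generalizing w with
  | nil =>
    obtain rfl := Option.some.inj h
    exact fun hw => ⟨hw, rfl⟩
  | cons I L ih =>
    obtain ⟨v, hv, h⟩ := Option.bind_eq_some_iff.1 h
    exact (sameReduced_of_apply hv).trans (ih h)

/-- A deformation of the 3-line graph of the first example into the empty diagram, with one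
Reidemeister move, swing, zigzag or circle deletion after each group of commutations.
The first five instructions undo a curl below a cap, by a detour through a zigzag. -/
def exampleDeformation : List Instruction :=
  [.unmove 22 5 .zigzag₁, .lower 22 21, .unmove 22 6 (.capSwing false), .lower 24 23,
      .move 21 5 (.RI₂ false),
    .lower 3 0, .lower 4 1, .lower 5 2, .lower 6 4, .move 3 0 .zigzag₁,
    .raise 21 25, .move 25 0 .zigzag₂,
    .move 6 4 (.cupSwing true),
    .lower 6 5, .lower 8 6, .unmove 7 5 (.RIII true false),
    .lower 10 9, .move 10 5 (.RII false),
    .move 8 6 (.RIII false true),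
    .move 10 7 (.RII false),
    .raise 2 7, .move 7 7 (.cupSwing true),
    .raise 1 7, .move 7 8 (.cupSwing false),
    .raise 8 17, .move 17 7 (.RII true),
    .raise 7 18, .move 18 2 .circle,
    .lower 5 4, .unmove 3 4 (.cupSwing false),
    .lower 6 4, .lower 7 5, .unmove 6 3 (.RIII true true),
    .raise 8 10, .move 10 3 (.RII false),
    .raise 2 5, .unmove 5 2 (.cupSwing false),
    .raise 1 5, .unmove 5 1 (.cupSwing true),
    .raise 6 12, .move 12 1 (.RII true),
    .raise 5 11, .move 11 2 .circle,
    .lower 2 1, .unmove 2 1 (.cupSwing false),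
    .lower 4 3, .unmove 4 2 (.RIII true true),
    .lower 7 6, .move 7 2 (.RII false),
    .raise 2 4, .move 4 3 (.cupSwing true),
    .move 5 4 (.RII false),
    .move 4 3 .circle,
    .move 3 2 (.RII true),
    .raise 1 3, .move 3 1 .circle,
    .move 1 1 .circle,
    .move 0 0 .circle]

theorem L_exampleDiagram_true : (exampleDiagram true).L = ReducedLink.empty := by
  have h : applyAll exampleDeformation (threeLineWord (exampleWord true)) = some [] := by
    decide +kernel
  obtain ⟨_, h⟩ := sameReduced_of_applyAll h (exampleDiagram true).threeLine.2
  exact h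

/-! ### The linking number of two components -/

/-- The direction label of a directed arc: an integer from the table, with the sign reversed for the
downward direction. -/
def dirLabel (rows : List (List ℤ)) (x : DirArc) : ℤ :=
  bif x.2 then (rows.getD x.1.1 []).getD x.1.2 0 else -(rows.getD x.1.1 []).getD x.1.2 0

/-- The labels above an elementary piece are compatible with those below it. -/
def layerCompatible (x : ℕ × LinkPiece) (r r' : List ℤ) : Bool :=
  r.take x.1 == r'.take x.1 &&
    r.drop (x.1 + (source x.2).length) == r'.drop (x.1 + (target x.2).length) &&
    match x.2 with
    | .cup => r'.getD x.1 0 == -r'.getD (x.1 + 1) 0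
    | .cap => r.getD x.1 0 == -r.getD (x.1 + 1) 0
    | .cross _ => r.getD x.1 0 == r'.getD (x.1 + 1) 0 && r.getD (x.1 + 1) 0 == r'.getD x.1 0

/-- The table of labels has one row for each level of the word, and the labels are constant along
oriented components. -/
def compatible (w : Word LinkPiece) (rows : List (List ℤ)) : Bool :=
  (List.range w.length).all fun l =>
    layerCompatible (w.getD l (0, .cup)) (rows.getD l []) (rows.getD (l + 1) [])

/-- The table of labels that results if the left ends of the cups have the labels in the first list,
in this order. -/
def labelRows : List ℤ → List ℤ → Word LinkPiece → List (List ℤ)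
  | _, r, [] => [r]
  | cs, r, (i, .cup) :: w =>
      r :: labelRows cs.tail (r.take i ++ cs.headD 0 :: -cs.headD 0 :: r.drop i) w
  | cs, r, (i, .cap) :: w => r :: labelRows cs (r.take i ++ r.drop (i + 2)) w
  | cs, r, (i, .cross _) :: w =>
      r :: labelRows cs (r.take i ++ r.getD (i + 1) 0 :: r.getD i 0 :: r.drop (i + 2)) w

theorem getD_eq_of_take_eq {α : Type} {r r' : List α} {i p : ℕ} (d : α)
    (h : r.take i = r'.take i) (hp : p < i) : r.getD p d = r'.getD p d := by
  have := congrArg (·[p]?) h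
  simp only [List.getElem?_take, if_pos hp] at this
  simp [List.getD, this]

theorem getD_eq_of_drop_eq {α : Type} {r r' : List α} {i i' : ℕ} (d : α) (q : ℕ)
    (h : r.drop i = r'.drop i') : r.getD (i + q) d = r'.getD (i' + q) d := by
  have := congrArg (·[q]?) h
  simp only [List.getElem?_drop] at this
  simp [List.getD, this]

theorem dirLabel_eq_of_follows {w : Word LinkPiece} {rows : List (List ℤ)}
    (h : compatible w rows = true) {x y : DirArc} (hxy : Follows w x y) :
    dirLabel rows x = dirLabel rows y := by
  have key : ∀ {l i : ℕ} {g : LinkPiece}, w[l]? = some (i, g) →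
      layerCompatible (i, g) (rows.getD l []) (rows.getD (l + 1) []) = true := by
    intro l i g hl
    have hlt : l < w.length := (List.getElem?_eq_some_iff.1 hl).1
    have := List.all_eq_true.1 h l (List.mem_range.2 hlt)
    simpa [List.getD, hl] using this
  cases hxy with
  | @pass x y d hp =>
    cases hp with
    | @left l i p g hl hp =>
      have := key hl
      simp only [layerCompatible, Bool.and_eq_true, beq_iff_eq] at this
      simp only [dirLabel, getD_eq_of_take_eq 0 this.1.1 hp]
    | @right l i g q hl =>
      have := key hl
      simp only [layerCompatible, Bool.and_eq_true, beq_iff_eq] at this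
      simp only [dirLabel, getD_eq_of_drop_eq 0 q this.1.2]
  | cup d hl =>
    have := key hl
    simp only [layerCompatible, Bool.and_eq_true, beq_iff_eq] at this
    cases d <;> simp only [dirLabel, Bool.not_true, Bool.not_false, cond_true, cond_false, this.2,
      neg_neg]
  | cap d hl =>
    have := key hl
    simp only [layerCompatible, Bool.and_eq_true, beq_iff_eq] at this
    cases d <;> simp only [dirLabel, Bool.not_true, Bool.not_false, cond_true, cond_false, this.2,
      neg_neg]
  | cross₁ d hl =>
    have := key hl
    simp only [layerCompatible, Bool.and_eq_true, beq_iff_eq] at this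
    simp only [dirLabel, this.2.1]
  | cross₂ d hl =>
    have := key hl
    simp only [layerCompatible, Bool.and_eq_true, beq_iff_eq] at this
    simp only [dirLabel, this.2.2]

theorem dirLabel_eq_of_sameOriented {w : Word LinkPiece} {rows : List (List ℤ)}
    (h : compatible w rows = true) {x y : DirArc} (hxy : SameOriented w x y) :
    dirLabel rows x = dirLabel rows y := by
  induction hxy with
  | rel _ _ h' => exact dirLabel_eq_of_follows h h'
  | refl => rfl
  | symm _ _ _ ih => exact ih.symm
  | trans _ _ _ _ _ ih ih' => exact ih.trans ih'

/-- The next arc on the way along a component. -/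
def nextArc (w : Word LinkPiece) : DirArc → Option DirArc
  | ((l, p), true) =>
      match w[l]? with
      | none => none
      | some (i, g) =>
          if p < i then some ((l + 1, p), true)
          else if p < i + (source g).length then
            match g with
            | .cup => none
            | .cap => some ((l, if p = i then i + 1 else i), false)
            | .cross _ => some ((l + 1, if p = i then i + 1 else i), true)
          else some ((l + 1, i + (target g).length + (p - (i + (source g).length))), true)
  | ((0, _), false) => none
  | ((l + 1, p), false) =>
      match w[l]? with
      | none => none
      | some (i, g) =>
          if p < i then some ((l, p), false)
          else if p < i + (target g).length then
            match g with
            | .cup => some ((l + 1, if p = i then i + 1 else i), true)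
            | .cap => none
            | .cross _ => some ((l, if p = i then i + 1 else i), false)
          else some ((l, i + (source g).length + (p - (i + (target g).length))), false)

theorem sameOriented_of_nextArc {w : Word LinkPiece} {x y : DirArc} (h : nextArc w x = some y) :
    SameOriented w x y := by
  obtain ⟨⟨l, p⟩, d⟩ := x
  rcases d with _ | _
  · rcases l with _ | l
    · simp [nextArc] at h
    simp only [nextArc] at h
    split at h
    · cases h
    rename_i i g hl
    by_cases h1 : p < i
    · rw [if_pos h1] at h
      cases h
      exact .symm _ _ (.rel _ _ (.pass _ (.left hl h1)))
    rw [if_neg h1] at h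
    by_cases h2 : p < i + (target g).length
    · rw [if_pos h2] at h
      rcases g with _ | _ | s <;> simp only [target, List.length_cons, List.length_nil] at h h2
      · cases h
        split_ifs with h3
        · subst h3
          exact .rel _ _ (.cup false hl)
        · obtain rfl : p = i + 1 := by omega
          exact .symm _ _ (.rel _ _ (.cup true hl))
      · cases h
      · cases h
        split_ifs with h3
        · subst h3
          exact .symm _ _ (.rel _ _ (.cross₂ false hl))
        · obtain rfl : p = i + 1 := by omega
          exact .symm _ _ (.rel _ _ (.cross₁ false hl))
    · rw [if_neg h2] at h
      cases h
      obtain ⟨q, rfl⟩ := Nat.exists_eq_add_of_le (not_lt.1 h2)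
      rw [Nat.add_sub_cancel_left]
      exact .symm _ _ (.rel _ _ (.pass _ (.right q hl)))
  · simp only [nextArc] at h
    split at h
    · cases h
    rename_i i g hl
    by_cases h1 : p < i
    · rw [if_pos h1] at h
      cases h
      exact .rel _ _ (.pass _ (.left hl h1))
    rw [if_neg h1] at h
    by_cases h2 : p < i + (source g).length
    · rw [if_pos h2] at h
      rcases g with _ | _ | s <;> simp only [source, List.length_cons, List.length_nil] at h h2
      · cases h
      · cases h
        split_ifs with h3
        · subst h3
          exact .rel _ _ (.cap true hl)
        · obtain rfl : p = i + 1 := by omega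
          exact .symm _ _ (.rel _ _ (.cap false hl))
      · cases h
        split_ifs with h3
        · subst h3
          exact .rel _ _ (.cross₁ true hl)
        · obtain rfl : p = i + 1 := by omega
          exact .rel _ _ (.cross₂ true hl)
    · rw [if_neg h2] at h
      cases h
      obtain ⟨q, rfl⟩ := Nat.exists_eq_add_of_le (not_lt.1 h2)
      rw [Nat.add_sub_cancel_left]
      exact .rel _ _ (.pass _ (.right q hl))

/-- The first `n` steps along a component. -/
def arcsFrom (w : Word LinkPiece) : ℕ → DirArc → List DirArc
  | 0, x => [x]
  | n + 1, x => x :: ((nextArc w x).map (arcsFrom w n)).getD []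

theorem sameOriented_of_mem_arcsFrom {w : Word LinkPiece} {n : ℕ} {x y : DirArc}
    (h : y ∈ arcsFrom w n x) : SameOriented w x y := by
  induction n generalizing x with
  | zero =>
    obtain rfl := List.mem_singleton.1 h
    exact .refl _
  | succ n ih =>
    rcases List.mem_cons.1 h with rfl | h
    · exact .refl _
    · rcases hx : nextArc w x with _ | z
      · simp [hx] at h
      · simp only [hx, Option.map_some, Option.getD_some] at h
        exact .trans _ _ _ (sameOriented_of_nextArc hx) (ih h)

/-- The contribution of a layer to twice the linking number of two oriented components, which are given
by their sets of directed arcs. -/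
def crossingSum (X Y : DirArc → Bool) (l : ℕ) : Option (ℕ × LinkPiece) → ℤ
  | some (i, .cross s) =>
      ∑ d : Bool, ∑ d' : Bool,
        if (X ((l, i), d) = true ∧ Y ((l, i + 1), d') = true) ∨
            (Y ((l, i), d) = true ∧ X ((l, i + 1), d') = true) then
          (if s = (d == d') then 1 else -1)
        else 0
  | _ => 0

theorem linkingNumber_eq {w : Word LinkPiece} {x y : DirArc} {X Y : DirArc → Bool}
    (hX : ∀ l i s, w[l]? = some (i, .cross s) → ∀ d, ∀ p ∈ [i, i + 1],
      (SameOriented w x ((l, p), d) ↔ X ((l, p), d) = true))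
    (hY : ∀ l i s, w[l]? = some (i, .cross s) → ∀ d, ∀ p ∈ [i, i + 1],
      (SameOriented w y ((l, p), d) ↔ Y ((l, p), d) = true)) :
    linkingNumber w x y = ((∑ l ∈ Finset.range w.length, crossingSum X Y l w[l]? : ℤ) : ℚ) / 2 := by
  unfold linkingNumber
  rw [Int.cast_sum]
  congr 1
  refine Finset.sum_congr rfl fun l _ => ?_
  rcases hl : w[l]? with _ | ⟨i, _ | _ | s⟩
  · simp [crossingSum]
  · simp [crossingSum]
  · simp [crossingSum]
  · simp only [crossingSum, Int.cast_sum]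
    refine Finset.sum_congr rfl fun d _ => Finset.sum_congr rfl fun d' _ => ?_
    have hX0 := hX l i s hl d i (by simp)
    have hX1 := hX l i s hl d' (i + 1) (by simp)
    have hY0 := hY l i s hl d i (by simp)
    have hY1 := hY l i s hl d' (i + 1) (by simp)
    simp only [hX0, hX1, hY0, hY1]
    split_ifs <;> simp

/-- A check that all directed arcs at crossings with the label of `x` are among the first `n` steps
from `x`. -/
def reachesLabel (w : Word LinkPiece) (rows : List (List ℤ)) (n : ℕ) (x : DirArc) : Bool :=
  (List.range w.length).all fun l =>
    match w[l]? with
    | some (i, .cross _) =>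
        [i, i + 1].all fun p => [false, true].all fun d =>
          dirLabel rows x != dirLabel rows ((l, p), d) || decide (((l, p), d) ∈ arcsFrom w n x)
    | _ => true

theorem sameOriented_iff_dirLabel {w : Word LinkPiece} {rows : List (List ℤ)}
    (h : compatible w rows = true) {n : ℕ} {x : DirArc} (hx : reachesLabel w rows n x = true)
    (l i : ℕ) (s : Bool) (hl : w[l]? = some (i, .cross s)) (d : Bool) (p : ℕ)
    (hp : p ∈ [i, i + 1]) :
    SameOriented w x ((l, p), d) ↔ (dirLabel rows x == dirLabel rows ((l, p), d)) = true := by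
  rw [beq_iff_eq]
  refine ⟨dirLabel_eq_of_sameOriented h, fun e => sameOriented_of_mem_arcsFrom (n := n) ?_⟩
  have := List.all_eq_true.1 hx l (List.mem_range.2 (List.getElem?_eq_some_iff.1 hl).1)
  simp only [hl] at this
  have := List.all_eq_true.1 (List.all_eq_true.1 this p hp) d (by simp)
  simpa [e] using this

/-- Labels for two components of the 3-line graph of the second example: the component that turns at
the lower vertex from one inner edge to the other has label `1`, and the component of the middle line of
the right outer edge has label `2`. -/
def exampleLabels : List (List ℤ) :=
  labelRows [0, 0, 0, 0, 2, 0, 1, 0] [] (threeLineWord (exampleWord false))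

theorem exists_linkingNumber_ne_zero :
    ∃ x y : DirArc,
      IsArc (exampleDiagram false).threeLine.1 x.1 ∧ IsArc (exampleDiagram false).threeLine.1 y.1 ∧
      ¬ SameComponent (exampleDiagram false).threeLine.1 x.1 y.1 ∧
      linkingNumber (exampleDiagram false).threeLine.1 x y ≠ 0 := by
  change ∃ x y : DirArc,
      IsArc (threeLineWord (exampleWord false)) x.1 ∧
      IsArc (threeLineWord (exampleWord false)) y.1 ∧
      ¬ SameComponent (threeLineWord (exampleWord false)) x.1 y.1 ∧
      linkingNumber (threeLineWord (exampleWord false)) x y ≠ 0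
  have hc : compatible (threeLineWord (exampleWord false)) exampleLabels = true := by
    decide +kernel
  refine ⟨((9, 5), true), ((5, 7), true), ⟨List.replicate 12 (), by decide +kernel, by decide⟩,
    ⟨List.replicate 10 (), by decide +kernel, by decide⟩, ?_, ?_⟩
  · rintro ⟨d, d', h⟩
    have := dirLabel_eq_of_sameOriented hc h
    clear h
    revert d d'
    decide +kernel
  · rw [linkingNumber_eq
      (X := fun z => dirLabel exampleLabels ((9, 5), true) == dirLabel exampleLabels z)
      (Y := fun z => dirLabel exampleLabels ((5, 7), true) == dirLabel exampleLabels z)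
      (sameOriented_iff_dirLabel hc
        (n := 60) (x := ((9, 5), true)) (by decide +kernel))
      (sameOriented_iff_dirLabel hc (n := 60) (x := ((5, 7), true)) (by decide +kernel))]
    refine div_ne_zero (Int.cast_ne_zero.2 ?_) two_ne_zero
    decide +kernel

/-! ### The dual triangulation of the examples -/

instance : Fintype Leg := ⟨{.BL, .BR, .TL, .TR}, fun a => by cases a <;> decide⟩

/-- The label of a line point; a row of the table lists, for every arc of a level, the labels of its
three lines. -/
def lineLabel (rows : List (List (List ℕ))) (x : Arc × Fin 3) : ℕ :=
  ((rows.getD x.1.1 []).getD x.1.2 []).getD x.2 0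

/-- The labels above an elementary piece of a framed graph are compatible with those below it. -/
def lineLayerCompatible (x : ℕ × GraphPiece) (r r' : List (List ℕ)) : Prop :=
  r.take x.1 = r'.take x.1 ∧
    r.drop (x.1 + (source x.2).length) = r'.drop (x.1 + (target x.2).length) ∧
    match x.2 with
    | .cup _ => ∀ j : Fin 3, (r'.getD x.1 []).getD j 0 = (r'.getD (x.1 + 1) []).getD j.rev 0
    | .cap _ => ∀ j : Fin 3, (r.getD x.1 []).getD j 0 = (r.getD (x.1 + 1) []).getD j.rev 0
    | .cross _ _ _ => r.getD x.1 [] = r'.getD (x.1 + 1) [] ∧ r.getD (x.1 + 1) [] = r'.getD x.1 []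
    | .twist t b => ∀ j : Fin 3, (r.getD x.1 []).getD j 0 = (r'.getD x.1 []).getD (twistPerm t b j) 0
    | .vertex _ => True

instance (x : ℕ × GraphPiece) (r r' : List (List ℕ)) : Decidable (lineLayerCompatible x r r') := by
  obtain ⟨i, _ | _ | _ | _ | _⟩ := x <;> unfold lineLayerCompatible <;> infer_instance

theorem lineLabel_eq_of_sameLine {w : Word GraphPiece} {rows : List (List (List ℕ))}
    (h : ∀ l < w.length,
      lineLayerCompatible (w.getD l (0, .vertex true)) (rows.getD l []) (rows.getD (l + 1) []))
    {x y : Arc × Fin 3} (hxy : SameLine w x y) : lineLabel rows x = lineLabel rows y := by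
  have key : ∀ {l i : ℕ} {g : GraphPiece}, w[l]? = some (i, g) →
      lineLayerCompatible (i, g) (rows.getD l []) (rows.getD (l + 1) []) := by
    intro l i g hl
    simpa [List.getD, hl] using h l (List.getElem?_eq_some_iff.1 hl).1
  induction hxy with
  | refl => rfl
  | symm _ _ _ ih => exact ih.symm
  | trans _ _ _ _ _ ih ih' => exact ih.trans ih'
  | rel x y hxy =>
    cases hxy with
    | @pass x y j hp =>
      cases hp with
      | @left l i p g hl hp => simp only [lineLabel, getD_eq_of_take_eq [] (key hl).1 hp]
      | @right l i g q hl => simp only [lineLabel, getD_eq_of_drop_eq [] q (key hl).2.1]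
    | cup j hl => exact (key hl).2.2 j
    | cap j hl => exact (key hl).2.2 j
    | cross₁ j hl => simp only [lineLabel, (key hl).2.2.1]
    | cross₂ j hl => simp only [lineLabel, (key hl).2.2.2]
    | twist j hl => exact (key hl).2.2 j

/-- Labels for the twelve lines of the examples: `1, 2, 3` and `4, 5, 6` for the left and the right
outer edge, `7, 8, 9` and `10, 11, 12` for the inner edges. -/
def exampleLines : List (List (List ℕ)) :=
  [[],
    [[1, 2, 3], [3, 2, 1]],
    [[1, 2, 3], [3, 2, 1], [4, 5, 6], [6, 5, 4]],
    [[1, 2, 3], [7, 8, 9], [10, 11, 12], [6, 5, 4]],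
    [[1, 2, 3], [7, 9, 8], [10, 11, 12], [6, 5, 4]],
    [[1, 2, 3], [9, 7, 8], [10, 11, 12], [6, 5, 4]],
    [[1, 2, 3], [9, 7, 8], [11, 10, 12], [6, 5, 4]],
    [[1, 2, 3], [9, 7, 8], [11, 12, 10], [6, 5, 4]],
    [[1, 2, 3], [11, 12, 10], [9, 7, 8], [6, 5, 4]],
    [[1, 2, 3], [2, 3, 1], [4, 6, 5], [6, 5, 4]],
    [[1, 3, 2], [2, 3, 1], [4, 6, 5], [6, 5, 4]],
    [[1, 3, 2], [2, 3, 1], [4, 6, 5], [5, 6, 4]],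
    [[4, 6, 5], [5, 6, 4]],
    []]

/-- The lower vertex (`false`) and the upper vertex (`true`) of the examples. -/
def exampleVertex (s b : Bool) : Vertex (exampleWord s) :=
  ⟨bif b then (8, 1) else (2, 1), false, by cases s <;> cases b <;> rfl⟩

theorem exists_eq_exampleVertex {s : Bool} (v : Vertex (exampleWord s)) :
    ∃ b, v = exampleVertex s b := by
  obtain ⟨⟨l, p⟩, c, h⟩ := v
  have hl : l < 13 := (List.getElem?_eq_some_iff.1 h).1
  interval_cases l <;> simp [exampleWord, twists] at h
  · exact ⟨false, Subtype.ext (by simp [exampleVertex, h.1])⟩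
  · exact ⟨true, Subtype.ext (by simp [exampleVertex, h.1])⟩

/-- The vertices of the examples correspond to the two tetrahedra. -/
def exampleVertexEquiv (s : Bool) : Vertex (exampleWord s) ≃ Fin 2 where
  toFun v := if v.1.1 = 2 then 0 else 1
  invFun t := exampleVertex s (decide (t = 1))
  left_inv v := by
    obtain ⟨b, rfl⟩ := exists_eq_exampleVertex v
    cases b <;> rfl
  right_inv t := by
    fin_cases t <;> rfl

/-- The edge ends of the lower vertex (`false`) and of the upper vertex (`true`) correspond to the
vertices of the two tetrahedra. -/
def exampleLegEquiv (b : Bool) : Leg ≃ Fin 4 where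
  toFun
    | .BL => bif b then 1 else 0
    | .BR => bif b then 0 else 1
    | .TL => bif b then 3 else 2
    | .TR => bif b then 2 else 3
  invFun := bif b then ![.BR, .BL, .TR, .TL] else ![.BL, .BR, .TL, .TR]
  left_inv a := by cases b <;> cases a <;> rfl
  right_inv i := by cases b <;> fin_cases i <;> rfl

/-- The labelling of the edge ends of the examples by the vertices of the dual tetrahedra. -/
def exampleLabelling (s : Bool) (v : Vertex (exampleWord s)) : Leg ≃ Fin 4 :=
  exampleLegEquiv (decide (v.1.1 = 8))

theorem exampleLabelling_exampleVertex (s b : Bool) :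
    exampleLabelling s (exampleVertex s b) = exampleLegEquiv b := by
  cases b <;> rfl

theorem exampleDiagram_isDual (s : Bool) : (exampleDiagram s).IsDual exampleTriangulation := by
  have hlab : ∀ {x y : Arc × Fin 3}, SameLine (exampleWord s) x y →
      lineLabel exampleLines x = lineLabel exampleLines y :=
    lineLabel_eq_of_sameLine (by cases s <;> decide +kernel)
  refine ⟨exampleVertexEquiv s, exampleLabelling s, ?_⟩
  intro v v' a a' hne hedge
  obtain ⟨b, rfl⟩ : ∃ b, v = exampleVertex s b := exists_eq_exampleVertex v
  obtain ⟨b', rfl⟩ : ∃ b, v' = exampleVertex s b := exists_eq_exampleVertex v'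
  obtain ⟨j₀, j₀', h₀⟩ := hedge
  have h₀ := hlab h₀
  have hne' : (b, a) ≠ (b', a') := fun e => hne (by cases e; rfl)
  let arc : Bool → Leg → Arc := fun b a => (exampleVertex true b).arc a
  have finite : ∀ b b' a a', (b, a) ≠ (b', a') → ∀ j₀ j₀',
      lineLabel exampleLines (arc b a, j₀) = lineLabel exampleLines (arc b' a', j₀') →
      let σ := bif b then examplePerm.symm else examplePerm
      b' = !b ∧ σ (exampleLegEquiv b a) = exampleLegEquiv b' a' ∧ ∀ j j' : Fin 3,
        lineLabel exampleLines (arc b a, j) = lineLabel exampleLines (arc b' a', j') →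
        σ (exampleLegEquiv b (lineLeg a j)) = exampleLegEquiv b' (lineLeg a' j') := by
    decide +kernel
  obtain ⟨rfl, h1, h2⟩ := finite b b' a a' hne' j₀ j₀' h₀
  refine ⟨bif b then examplePerm.symm else examplePerm, ?_, ?_, ?_⟩
  · cases b <;> rfl
  · rw [exampleLabelling_exampleVertex, exampleLabelling_exampleVertex, h1]
  · intro j j' h
    rw [exampleLabelling_exampleVertex, exampleLabelling_exampleVertex]
    exact h2 j j' (hlab h)

/-! ### The double of a tetrahedron is the 3-sphere -/

/-- The least coordinate of a point. -/
def minCoord (x : Fin 4 → ℝ) : ℝ := Finset.univ.inf' Finset.univ_nonempty x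

theorem minCoord_le (x : Fin 4 → ℝ) (i : Fin 4) : minCoord x ≤ x i :=
  Finset.inf'_le _ (Finset.mem_univ i)

theorem exists_eq_minCoord (x : Fin 4 → ℝ) : ∃ i, x i = minCoord x := by
  obtain ⟨i, -, h⟩ := Finset.exists_mem_eq_inf' Finset.univ_nonempty x
  exact ⟨i, h.symm⟩

theorem continuous_minCoord : Continuous minCoord :=
  Continuous.finset_inf'_apply _ fun i _ => continuous_apply i

/-- The tetrahedron with its barycentre at the origin, bent by `ε` times the least coordinate in the
direction orthogonal to it; the boundary stays where it is. -/
noncomputable def bend (ε : ℝ) (x : Fin 4 → ℝ) : EuclideanSpace ℝ (Fin 4) :=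
  WithLp.toLp 2 fun i => x i - 1 / 4 + ε * minCoord x

/-- Each ray from the origin meets the two bent tetrahedra at most once, apart from their common
boundary. -/
theorem bend_injective {ε ε' : ℝ} (hε : ε = 1 ∨ ε = -1) (hε' : ε' = 1 ∨ ε' = -1)
    {x x' : Fin 4 → ℝ} (hx : x ∈ stdSimplex ℝ (Fin 4)) (hx' : x' ∈ stdSimplex ℝ (Fin 4)) {c : ℝ}
    (hc : 0 < c) (h : bend ε x = c • bend ε' x') : x = x' ∧ (ε = ε' ∨ minCoord x = 0) := by
  have hi : ∀ i, x i - 1 / 4 + ε * minCoord x = c * (x' i - 1 / 4 + ε' * minCoord x') := fun i => by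
    have := congrArg (fun v : EuclideanSpace ℝ (Fin 4) => v i) h
    simpa [bend] using this
  obtain ⟨i₀, h₀⟩ := exists_eq_minCoord x
  obtain ⟨i₁, h₁⟩ := exists_eq_minCoord x'
  have hm : 0 ≤ minCoord x := h₀ ▸ hx.1 i₀
  have hm' : 0 ≤ minCoord x' := h₁ ▸ hx'.1 i₁
  have hs := hx.2
  have hs' := hx'.2
  rw [Fin.sum_univ_four] at hs hs'
  -- the component orthogonal to the tetrahedron
  have horth : ε * minCoord x = c * (ε' * minCoord x') := by
    have e : (x 0 + x 1 + x 2 + x 3) - 1 + 4 * (ε * minCoord x) =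
        c * ((x' 0 + x' 1 + x' 2 + x' 3) - 1 + 4 * (ε' * minCoord x')) := by
      linear_combination hi 0 + hi 1 + hi 2 + hi 3
    rw [hs, hs'] at e
    linarith
  have hpar : ∀ i, x i - 1 / 4 = c * (x' i - 1 / 4) := fun i => by
    linear_combination hi i - horth
  have hmin : minCoord x - 1 / 4 = c * (minCoord x' - 1 / 4) := by
    apply le_antisymm
    · rw [← h₁, ← hpar i₁]
      linarith [minCoord_le x i₁]
    · rw [← h₀, hpar i₀]
      exact mul_le_mul_of_nonneg_left (by linarith [minCoord_le x' i₀]) hc.le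
  have hcone : c = 1 ∧ (ε = ε' ∨ minCoord x = 0) := by
    have hcm : 0 ≤ c * minCoord x' := mul_nonneg hc.le hm'
    rcases hε with rfl | rfl <;> rcases hε' with rfl | rfl
    · exact ⟨by linarith, .inl rfl⟩
    · exact ⟨by linarith, .inr (by linarith)⟩
    · exact ⟨by linarith, .inr (by linarith)⟩
    · exact ⟨by linarith, .inl rfl⟩
  refine ⟨funext fun i => ?_, hcone.2⟩
  have := hpar i
  rw [hcone.1] at this
  linarith

theorem bend_ne_zero {ε : ℝ} (hε : ε = 1 ∨ ε = -1) {x : Fin 4 → ℝ}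
    (hx : x ∈ stdSimplex ℝ (Fin 4)) : bend ε x ≠ 0 := by
  intro h
  have hi : ∀ i, x i - 1 / 4 + ε * minCoord x = 0 := fun i => by
    have := congrArg (fun v : EuclideanSpace ℝ (Fin 4) => v i) h
    simpa [bend] using this
  have hs := hx.2
  rw [Fin.sum_univ_four] at hs
  have hm : minCoord x = 0 := by
    rcases hε with rfl | rfl <;> linarith [hi 0, hi 1, hi 2, hi 3]
  obtain ⟨i, h⟩ := exists_eq_minCoord x
  have := hi i
  rw [h, hm] at this
  norm_num at this

/-- Central projection of the bent tetrahedra covers the sphere. -/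
theorem exists_smul_bend {u : EuclideanSpace ℝ (Fin 4)} (hu : u ≠ 0) :
    ∃ (ε : ℝ) (x : Fin 4 → ℝ) (r : ℝ), (ε = 1 ∨ ε = -1) ∧ x ∈ stdSimplex ℝ (Fin 4) ∧ 0 < r ∧
      bend ε x = r • u := by
  set μ : ℝ := (u 0 + u 1 + u 2 + u 3) / 4 with hμ
  set p : Fin 4 → ℝ := fun i => u i - μ with hp
  have hsum : p 0 + p 1 + p 2 + p 3 = 0 := by simp only [hp, hμ]; ring
  have hq := minCoord_le p
  obtain ⟨i₀, h₀⟩ := exists_eq_minCoord p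
  have hpos : 0 < |μ| - minCoord p := by
    by_contra hneg
    have hμ0 : μ = 0 := by
      have : |μ| ≤ 0 := by linarith [hq 0, hq 1, hq 2, hq 3]
      simpa using this
    have hq0 : 0 ≤ minCoord p := by linarith [abs_nonneg μ]
    apply hu
    ext i
    have : p i = 0 := by
      fin_cases i <;> simp only [Fin.zero_eta, Fin.mk_one, Fin.reduceFinMk] <;>
        linarith [hq 0, hq 1, hq 2, hq 3]
    simpa [hp, hμ0] using this
  set r : ℝ := 1 / (4 * (|μ| - minCoord p)) with hr
  have hrpos : 0 < r := by positivity
  have hr4 : r * (|μ| - minCoord p) = 1 / 4 := by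
    rw [hr]
    field_simp
  set x : Fin 4 → ℝ := fun i => 1 / 4 + r * p i with hx
  have hmin : minCoord x = r * |μ| := by
    apply le_antisymm
    · refine (minCoord_le x i₀).trans (le_of_eq ?_)
      simp only [hx, h₀]
      linarith
    · obtain ⟨i, hi⟩ := exists_eq_minCoord x
      rw [← hi]
      simp only [hx]
      nlinarith [hq i]
  have hmem : x ∈ stdSimplex ℝ (Fin 4) := by
    refine ⟨fun i => ?_, ?_⟩
    · refine le_trans ?_ (minCoord_le x i)
      rw [hmin]
      positivity
    · rw [Fin.sum_univ_four]
      simp only [hx]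
      linear_combination r * hsum
  obtain ⟨ε, hε, hεμ⟩ : ∃ ε : ℝ, (ε = 1 ∨ ε = -1) ∧ ε * |μ| = μ := by
    rcases abs_cases μ with ⟨h, -⟩ | ⟨h, -⟩
    · exact ⟨1, .inl rfl, by rw [h, one_mul]⟩
    · exact ⟨-1, .inr rfl, by rw [h]; ring⟩
  refine ⟨ε, x, r, hε, hmem, hrpos, ?_⟩
  ext i
  simp only [bend, hmin, PiLp.smul_apply, smul_eq_mul]
  simp only [hx, hp]
  linear_combination r * hεμ

/-- Central projection of a bent tetrahedron to the sphere. -/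
noncomputable def toSphere (ε : ℝ) (hε : ε = 1 ∨ ε = -1) (x : stdSimplex ℝ (Fin 4)) : Sphere3 :=
  ⟨‖bend ε x.1‖⁻¹ • bend ε x.1, by
    rw [mem_sphere_zero_iff_norm, norm_smul, norm_inv, norm_norm,
      inv_mul_cancel₀ (norm_ne_zero_iff.2 (bend_ne_zero hε x.2))]⟩

theorem continuous_toSphere (ε : ℝ) (hε : ε = 1 ∨ ε = -1) : Continuous (toSphere ε hε) := by
  have hb : Continuous fun x : stdSimplex ℝ (Fin 4) => bend ε x.1 := by
    unfold bend
    refine (PiLp.continuous_toLp 2 _).comp (continuous_pi fun i => ?_)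
    exact (((continuous_apply i).comp continuous_subtype_val).sub continuous_const).add
      (continuous_const.mul (continuous_minCoord.comp continuous_subtype_val))
  refine Continuous.subtype_mk (Continuous.smul (hb.norm.inv₀ fun x => ?_) hb) _
  exact norm_ne_zero_iff.2 (bend_ne_zero hε x.2)

theorem toSphere_injective {ε ε' : ℝ} {hε : ε = 1 ∨ ε = -1} {hε' : ε' = 1 ∨ ε' = -1}
    {x x' : stdSimplex ℝ (Fin 4)} (h : toSphere ε hε x = toSphere ε' hε' x') :
    x = x' ∧ (ε = ε' ∨ minCoord x.1 = 0) := by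
  have h1 := norm_pos_iff.2 (bend_ne_zero hε x.2)
  have h2 := norm_pos_iff.2 (bend_ne_zero hε' x'.2)
  have h := congrArg Subtype.val h
  simp only [toSphere] at h
  obtain ⟨h3, h4⟩ := bend_injective hε hε' x.2 x'.2 (c := ‖bend ε x.1‖ * ‖bend ε' x'.1‖⁻¹)
    (by positivity) (by
      rw [← smul_smul, ← h, smul_smul, mul_inv_cancel₀ h1.ne', one_smul])
  exact ⟨Subtype.ext h3, h4⟩

theorem toSphere_surjective (u : Sphere3) :
    ∃ (ε : ℝ) (hε : ε = 1 ∨ ε = -1) (x : stdSimplex ℝ (Fin 4)), toSphere ε hε x = u := by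
  have hu : ‖u.1‖ = 1 := mem_sphere_zero_iff_norm.1 u.2
  obtain ⟨ε, x, r, hε, hx, hr, h⟩ := exists_smul_bend (u := u.1) (norm_pos_iff.1 (by rw [hu]; simp))
  refine ⟨ε, hε, ⟨x, hx⟩, Subtype.ext ?_⟩
  simp only [toSphere, h, norm_smul, hu, mul_one, Real.norm_eq_abs, abs_of_pos hr, smul_smul,
    inv_mul_cancel₀ hr.ne', one_smul]

theorem toSphere_eq_of_coord_eq_zero {ε ε' : ℝ} {hε : ε = 1 ∨ ε = -1} {hε' : ε' = 1 ∨ ε' = -1}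
    {x : stdSimplex ℝ (Fin 4)} {i : Fin 4} (h : x.1 i = 0) :
    toSphere ε hε x = toSphere ε' hε' x := by
  have hm : minCoord x.1 = 0 := by
    obtain ⟨j, hj⟩ := exists_eq_minCoord x.1
    exact le_antisymm (h ▸ minCoord_le x.1 i) (hj ▸ x.2.1 j)
  apply Subtype.ext
  simp only [toSphere, bend, hm, mul_zero]

/-- Permutation of the vertices of the standard tetrahedron. -/
def permuteSimplex (σ : Equiv.Perm (Fin 4)) (x : stdSimplex ℝ (Fin 4)) : stdSimplex ℝ (Fin 4) :=
  ⟨fun i => x.1 (σ i), fun i => x.2.1 _, by rw [Equiv.sum_comp σ x.1]; exact x.2.2⟩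

theorem continuous_permuteSimplex (σ : Equiv.Perm (Fin 4)) : Continuous (permuteSimplex σ) := by
  have h : Continuous fun (x : stdSimplex ℝ (Fin 4)) (i : Fin 4) => x.1 (σ i) :=
    continuous_pi fun i => (continuous_apply (σ i)).comp continuous_subtype_val
  exact h.subtype_mk _

/-- All faces of the two tetrahedra are glued by the same permutation of the vertices, so that the two
tetrahedra form the double of one of them: they go to the two hemispheres. -/
noncomputable def doubleToSphere (z : Fin 2 × stdSimplex ℝ (Fin 4)) : Sphere3 :=
  if z.1 = 0 then toSphere 1 (.inl rfl) z.2
  else toSphere (-1) (.inr rfl) (permuteSimplex examplePerm z.2)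

theorem continuous_doubleToSphere : Continuous doubleToSphere := by
  rw [continuous_prod_of_discrete_left]
  intro t
  by_cases ht : t = 0
  · simpa [doubleToSphere, ht] using continuous_toSphere 1 (.inl rfl)
  · simp only [doubleToSphere, ht, if_false]
    refine (continuous_toSphere (-1) (.inr rfl)).comp ?_
    exact continuous_permuteSimplex _

theorem exampleTriangulation_triangulates : exampleTriangulation.Triangulates Sphere3 := by
  let R : Fin 2 × stdSimplex ℝ (Fin 4) → Fin 2 × stdSimplex ℝ (Fin 4) → Prop := fun x y =>
    ∃ f : Fin 4, x.2.1 f = 0 ∧ y.1 = (exampleTriangulation.glue x.1 f).1 ∧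
      ∀ i, y.2.1 ((exampleTriangulation.glue x.1 f).2 i) = x.2.1 i
  have hR : ∀ x y, R x y → doubleToSphere x = doubleToSphere y := by
    rintro ⟨t, x⟩ ⟨t', y⟩ ⟨f, hf, ht, hxy⟩
    simp only at hf ht hxy
    subst ht
    fin_cases t
    · have e : permuteSimplex examplePerm y = x := Subtype.ext (funext fun i => hxy i)
      change toSphere 1 (.inl rfl) x = toSphere (-1) (.inr rfl) (permuteSimplex examplePerm y)
      rw [e]
      exact toSphere_eq_of_coord_eq_zero hf
    · have e : permuteSimplex examplePerm x = y := Subtype.ext (funext fun i => by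
        have : y.1 (examplePerm.symm (examplePerm i)) = x.1 (examplePerm i) := hxy (examplePerm i)
        rw [Equiv.symm_apply_apply] at this
        exact this.symm)
      change toSphere (-1) (.inr rfl) (permuteSimplex examplePerm x) = toSphere 1 (.inl rfl) y
      rw [e]
      refine toSphere_eq_of_coord_eq_zero (i := examplePerm.symm f) ?_
      rw [← e]
      change x.1 (examplePerm (examplePerm.symm f)) = 0
      rwa [Equiv.apply_symm_apply]
  let F : Quot R → Sphere3 := Quot.lift doubleToSphere hR
  have glued : ∀ x y : stdSimplex ℝ (Fin 4), x = permuteSimplex examplePerm y →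
      minCoord x.1 = 0 → Quot.mk R (0, x) = Quot.mk R (1, y) := by
    rintro x y hxy hm
    obtain ⟨f, hf⟩ := exists_eq_minCoord x.1
    refine Quot.sound ⟨f, hf.trans hm, rfl, fun i => ?_⟩
    exact (congrFun (congrArg Subtype.val hxy) i).symm
  have hinj : Function.Injective F := by
    rintro ⟨t, x⟩ ⟨t', y⟩ h
    change doubleToSphere (t, x) = doubleToSphere (t', y) at h
    fin_cases t <;> fin_cases t'
    · change toSphere 1 (.inl rfl) x = toSphere 1 (.inl rfl) y at h
      rw [(toSphere_injective h).1]
    · change toSphere 1 (.inl rfl) x = toSphere (-1) (.inr rfl) (permuteSimplex examplePerm y) at h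
      obtain ⟨e, h | h⟩ := toSphere_injective h
      · norm_num at h
      · exact glued x y e h
    · change toSphere (-1) (.inr rfl) (permuteSimplex examplePerm x) = toSphere 1 (.inl rfl) y at h
      obtain ⟨e, h | h⟩ := toSphere_injective h.symm
      · norm_num at h
      · exact (glued y x e h).symm
    · change toSphere (-1) (.inr rfl) (permuteSimplex examplePerm x) =
        toSphere (-1) (.inr rfl) (permuteSimplex examplePerm y) at h
      have e := (toSphere_injective h).1
      have : x = y := Subtype.ext (funext fun i => by
        have := congrFun (congrArg Subtype.val e) (examplePerm.symm i)
        change x.1 (examplePerm (examplePerm.symm i)) = y.1 (examplePerm (examplePerm.symm i)) at this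
        rwa [Equiv.apply_symm_apply] at this)
      rw [this]
  have hsurj : Function.Surjective F := by
    intro u
    obtain ⟨ε, hε, x, rfl⟩ := toSphere_surjective u
    rcases hε with rfl | rfl
    · exact ⟨Quot.mk R (0, x), rfl⟩
    · refine ⟨Quot.mk R (1, permuteSimplex examplePerm.symm x), ?_⟩
      change toSphere (-1) (.inr rfl) (permuteSimplex examplePerm (permuteSimplex examplePerm.symm x)) = _
      congr 1
      exact Subtype.ext (funext fun i => congrArg x.1 (Equiv.symm_apply_apply examplePerm i))
  have : CompactSpace (stdSimplex ℝ (Fin 4)) :=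
    isCompact_iff_compactSpace.1 (isCompact_stdSimplex ℝ (Fin 4))
  have : CompactSpace exampleTriangulation.Realization := inferInstanceAs (CompactSpace (Quot R))
  exact ⟨Continuous.homeoOfEquivCompactToT2 (f := Equiv.ofBijective F ⟨hinj, hsurj⟩)
    (continuous_quot_lift hR continuous_doubleToSphere)⟩

end PachnerGraphs

theorem mainTheorem2 :
    ¬ (pachnerGraph Sphere3).Connected ∧
    exampleTriangulation.Triangulates Sphere3 ∧
    (∀ s : Bool, (exampleDiagram s).IsDual exampleTriangulation) ∧
    (exampleDiagram true).L = ReducedLink.empty ∧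
    (exampleDiagram false).L ≠ ReducedLink.empty ∧
    (∃ x y : DirArc,
      IsArc (exampleDiagram false).threeLine.1 x.1 ∧ IsArc (exampleDiagram false).threeLine.1 y.1 ∧
      ¬ SameComponent (exampleDiagram false).threeLine.1 x.1 y.1 ∧
      linkingNumber (exampleDiagram false).threeLine.1 x y ≠ 0) ∧
    ∃ a b : {g : FramedGraph // g.IsDualTo Sphere3},
      a.1 = (exampleDiagram true).graph ∧ b.1 = (exampleDiagram false).graph ∧
      ¬ (pachnerGraph Sphere3).Reachable a b := by
  let node (s : Bool) : {g : FramedGraph // g.IsDualTo Sphere3} :=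
    ⟨(exampleDiagram s).graph, exampleDiagram s, rfl, exampleTriangulation,
      exampleDiagram_isDual s, exampleTriangulation_triangulates⟩
  -- the reduced link of the first diagram is empty, so it has no odd two-colouring
  have hplus : ¬ OddColouring (threeLineWord (exampleWord true)) := fun h =>
    not_oddColouring_nil ((congrArg ReducedLink.Odd L_exampleDiagram_true).mp h)
  have hminus : (exampleDiagram false).L ≠ ReducedLink.empty := fun h =>
    not_oddColouring_nil ((congrArg ReducedLink.Odd h).mp oddColouring_exampleWord_false)
  have hreach : ¬ (pachnerGraph Sphere3).Reachable (node true) (node false) := fun h =>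
    hplus ((odd_iff_of_reachable h).2 oddColouring_exampleWord_false)
  exact ⟨fun h => hreach (h.preconnected _ _), exampleTriangulation_triangulates,
    exampleDiagram_isDual, L_exampleDiagram_true, hminus, exists_linkingNumber_ne_zero,
    node true, node false, rfl, rfl, hreach⟩
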